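/- **Soundness and completeness of first-order FDE (QFDE).** *Language.* A signature $\mathcal S=\langle\mathcal C,\mathcal P\rangle$ consists of an infinite set $\mathcal C$ of individual constants and a set $\mathcal P$ of predicate letters of finite arity containing a binary letter $\approx$ (identity). Formulas are built from atomic formulas with variables $v_0,v_1,\dots$ by $\neg,\land,\lor,\forall,\exists$, void quantifiers being excluded ($\forall xA$ and $\exists xA$ are formulas only if $x$ is free in $A$). $A(c/x)$ is the result of replacing the free occurrences of $x$ in $A$ by the constant $c$; sentences are formulas without free variables. *Deduction.* $\Gamma\vdash A$ means that there is a natural deduction derivation, consisting of sentences, of $A$ from premises in $\Gamma$ with the following rules. Brackets mark discharged hypotheses. - $A,B\,/\,A\land B$; $\;A\land B\,/\,A$; $\;A\land B\,/\,B$; $\;A\,/\,A\lor B$; $\;B\,/\,A\lor B$; from $A\lor B$ and derivations of $C$ from $[A]$ and of $C$ from $[B]$, infer $C$. - $\neg A\,/\,\neg(A\land B)$; $\;\neg B\,/\,\neg(A\land B)$; from $\neg(A\land B)$ and derivations of $C$ from $[\neg A]$ and of $C$ from $[\neg B]$, infer $C$; $\;\neg A,\neg B\,/\,\neg(A\lor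 B)$; $\;\neg(A\lor B)\,/\,\neg A$; $\;\neg(A\lor B)\,/\,\neg B$; $\;A\,/\,\neg\neg A$; $\;\neg\neg A\,/\,A$. - $(\forall I)$ $B\lor A(c/x)\,/\,B\lor\forall xA$; $\;(\forall E)$ $\forall xA\,/\,A(c/x)$; $\;(\exists I)$ $A(c/x)\,/\,\exists xA$; $\;(\exists E)$ from $\exists xA$ and a derivation of $C$ from $[A(c/x)]$, infer $C$. - $(\neg\forall I)$ $\neg A(c/x)\,/\,\neg\forall xA$; $\;(\neg\forall E)$ from $\neg\forall xA$ and a derivation of $C$ from $[\neg A(c/x)]$, infer $C$; $\;(\neg\exists I)$ $\neg A(c/x)\,/\,\neg\exists xA$; $\;(\neg\exists E)$ $\neg\exists xA\,/\,\neg A(c/x)$. - $(\approx I)$ $\,/\,c\approx c$; $\;(\approx E)$ $c_1\approx c_2,\ A(c_1/x)\,/\,A(c_2/x)$. In $(\forall I)$, $c$ occurs neither in $A$ or $B$ nor in any hypothesis on which $B\lor A(c/x)$ depends; in $(\neg\exists I)$, $c$ occurs neither in $A$ nor in any hypothesis on which $\neg A(c/x)$ depends; in $(\exists E)$ and $(\neg\forall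 E)$, $c$ occurs neither in $A$ or $C$ nor in any hypothesis on which the minor premise $C$ depends, other than the discharged one. *Semantics.* An $\mathcal S$-structure $\mathfrak A$ is a non-empty domain $D$ with an element $c^{\mathfrak A}\in D$ for each $c\in\mathcal C$ and, for each $n$-ary $P\in\mathcal P$, two relations $P_+^{\mathfrak A},P_-^{\mathfrak A}\subseteq D^n$, where $\approx_+^{\mathfrak A}$ is the identity relation on $D$. The diagram signature $\mathcal S_{\mathfrak A}$ adds to $\mathcal S$ a new constant $\bar a$, denoting $a$, for each $a\in D$; write $c^{\widehat{\mathfrak A}}$ for the denotation of a constant $c$ of $\mathcal S_{\mathfrak A}$. A valuation induced by $\mathfrak A$ is a map $v:\mathrm{Sent}(\mathcal S_{\mathfrak A})\to\{0,1\}$ such that, for all constants $c_i$ of $\mathcal S_{\mathfrak A}$ and all $A,B$: - $v(P(c_1,\dots,c_n))=1$ iff $\langle c_1^{\widehat{\mathfrak A}},\dots,c_n^{\widehat{\mathfrak A}}\rangle\in P_+^{\mathfrak A}$; $v(\neg P(c_1,\dots,c_n))=1$ iff $\langle c_1^{\widehat{\mathfrak A}},\dots,c_n^{\widehat{\mathfrak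 A}}\rangle\in P_-^{\mathfrak A}$; - $v(A\land B)=1$ iff $v(A)=1$ and $v(B)=1$; $v(A\lor B)=1$ iff $v(A)=1$ or $v(B)=1$; $v(\neg(A\land B))=1$ iff $v(\neg A)=1$ or $v(\neg B)=1$; $v(\neg(A\lor B))=1$ iff $v(\neg A)=1$ and $v(\neg B)=1$; $v(\neg\neg A)=1$ iff $v(A)=1$; - $v(\forall xA)=1$ iff $v(A(\bar a/x))=1$ for every $a\in D$; $v(\exists xA)=1$ iff $v(A(\bar a/x))=1$ for some $a\in D$; $v(\neg\forall xA)=1$ iff $v(\neg A(\bar a/x))=1$ for some $a\in D$; $v(\neg\exists xA)=1$ iff $v(\neg A(\bar a/x))=1$ for every $a\in D$. **Theorem.** Let $\mathcal S$ be a signature of any cardinality. 1. Every $\mathcal S$-structure $\mathfrak A$ induces exactly one valuation $v_{\mathfrak A}$. 2. Write $\mathfrak A\vDash A$ if $v_{\mathfrak A}(A)=1$, and $\Gamma\vDash A$ if $\mathfrak A\vDash A$ for every $\mathcal S$-structure $\mathfrak A$ such that $\mathfrak A\vDash B$ for all $B\in\Gamma$. Then for every $\Gamma\cup\{A\}\subseteq\mathrm{Sent}(\mathcal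 S)$: $\;\Gamma\vdash A$ if and only if $\Gamma\vDash A$. -/

import Mathlib

universe u v w

namespace QFDE

/-- A first-order signature: an infinite set of individual constants and, for each arity `n`, a set
of `n`-ary predicate letters, among which there is a binary letter `eq`, the identity symbol. -/
structure Signature where
  Const : Type u
  infinite : Infinite Const
  Pred : ℕ → Type v
  eq : Pred 2

/-- Terms: individual variables `v₀, v₁, …` and individual constants. -/
inductive Term (S : Signature.{u, v}) : Type u
  | var : ℕ → Term S
  | const : S.Const → Term S

/-- Expressions built with the usual formation rules; the proviso on void quantifiers is `WF`. -/
inductive Form (S : Signature.{u, v}) : Type (max u v)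
  | atom : {n : ℕ} → S.Pred n → (Fin n → Term S) → Form S
  | neg : Form S → Form S
  | and : Form S → Form S → Form S
  | or : Form S → Form S → Form S
  | all : ℕ → Form S → Form S
  | ex : ℕ → Form S → Form S

/-- Replace the variable `x` by the constant `c` in a term. -/
def Term.subst {S : Signature.{u, v}} (x : ℕ) (c : S.Const) : Term S → Term S
  | .var y => if y = x then .const c else .var y
  | .const d => .const d

namespace Form

variable {S : Signature.{u, v}}

/-- The set of variables with a free occurrence. -/
def FV : Form S → Set ℕ
  | atom _ t => {x | ∃ i, t i = Term.var x}
  | neg A => A.FV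
  | and A B => A.FV ∪ B.FV
  | or A B => A.FV ∪ B.FV
  | all x A => A.FV \ {x}
  | ex x A => A.FV \ {x}

/-- No quantifier is void: a quantifier on `x` is only applied where `x` is free. -/
def WF : Form S → Prop
  | atom _ _ => True
  | neg A => A.WF
  | and A B => A.WF ∧ B.WF
  | or A B => A.WF ∧ B.WF
  | all x A => x ∈ A.FV ∧ A.WF
  | ex x A => x ∈ A.FV ∧ A.WF

/-- `A(c/x)`: replace every free occurrence of `x` by the constant `c`. -/
def subst (x : ℕ) (c : S.Const) : Form S → Form S
  | atom P t => atom P fun i => (t i).subst x c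
  | neg A => neg (A.subst x c)
  | and A B => and (A.subst x c) (B.subst x c)
  | or A B => or (A.subst x c) (B.subst x c)
  | all y A => if y = x then all y A else all y (A.subst x c)
  | ex y A => if y = x then ex y A else ex y (A.subst x c)

/-- The constant `c` occurs in the formula. -/
def Occurs (c : S.Const) : Form S → Prop
  | atom _ t => ∃ i, t i = Term.const c
  | neg A => A.Occurs c
  | and A B => A.Occurs c ∨ B.Occurs c
  | or A B => A.Occurs c ∨ B.Occurs c
  | all _ A => A.Occurs c
  | ex _ A => A.Occurs c

theorem FV_subst (x : ℕ) (c : S.Const) (A : Form S) : (A.subst x c).FV = A.FV \ {x} := by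
  induction A with
  | atom P t =>
    ext y
    simp only [subst, FV, Set.mem_ofPred_eq, Set.mem_sdiff, Set.mem_singleton_iff]
    constructor
    · rintro ⟨i, hi⟩
      cases h : t i with
      | var z =>
        rw [h] at hi
        simp only [Term.subst] at hi
        split_ifs at hi with hz
        cases hi
        exact ⟨⟨i, h⟩, hz⟩
      | const d =>
        rw [h] at hi
        simp [Term.subst] at hi
    · rintro ⟨⟨i, hi⟩, hy⟩
      exact ⟨i, by simp [hi, Term.subst, hy]⟩
  | neg A ih => simpa [subst, FV] using ih
  | and A B ihA ihB => simp only [subst, FV, ihA, ihB, Set.union_sdiff_distrib]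
  | or A B ihA ihB => simp only [subst, FV, ihA, ihB, Set.union_sdiff_distrib]
  | all y A ih =>
    by_cases h : y = x
    · simp [subst, FV, h]
    · simp only [subst, FV, h, if_false, ih]
      exact Set.sdiff_sdiff_comm
  | ex y A ih =>
    by_cases h : y = x
    · simp [subst, FV, h]
    · simp only [subst, FV, h, if_false, ih]
      exact Set.sdiff_sdiff_comm

theorem WF_subst (x : ℕ) (c : S.Const) (A : Form S) (hA : A.WF) : (A.subst x c).WF := by
  induction A with
  | atom P t => trivial
  | neg A ih => exact ih hA
  | and A B ihA ihB => exact ⟨ihA hA.1, ihB hA.2⟩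
  | or A B ihA ihB => exact ⟨ihA hA.1, ihB hA.2⟩
  | all y A ih =>
    by_cases h : y = x
    · simpa [subst, h] using hA
    · simp only [subst, h, if_false, WF, FV_subst]
      exact ⟨⟨hA.1, h⟩, ih hA.2⟩
  | ex y A ih =>
    by_cases h : y = x
    · simpa [subst, h] using hA
    · simp only [subst, h, if_false, WF, FV_subst]
      exact ⟨⟨hA.1, h⟩, ih hA.2⟩

end Form

/-- Sentences: formulas without void quantifiers and without free variables. -/
def Sent (S : Signature.{u, v}) : Type (max u v) :=
  {A : Form S // A.WF ∧ A.FV = ∅}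

/-- Formulas (without void quantifiers) in which no variable other than `x` is free. -/
def Form1 (S : Signature.{u, v}) (x : ℕ) : Type (max u v) :=
  {A : Form S // A.WF ∧ A.FV ⊆ {x}}

namespace Sent

variable {S : Signature.{u, v}}

/-- The atomic sentence `P(c₁, …, cₙ)`. -/
def atom {n : ℕ} (P : S.Pred n) (c : Fin n → S.Const) : Sent S :=
  ⟨.atom P fun i => .const (c i), trivial, by simp [Form.FV]⟩

/-- The identity sentence `c₁ ≐ c₂`. -/
def eq (c₁ c₂ : S.Const) : Sent S := atom S.eq ![c₁, c₂]

def neg (A : Sent S) : Sent S := ⟨.neg A.1, A.2⟩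

def and (A B : Sent S) : Sent S :=
  ⟨.and A.1 B.1, ⟨A.2.1, B.2.1⟩, by simp [Form.FV, A.2.2, B.2.2]⟩

def or (A B : Sent S) : Sent S :=
  ⟨.or A.1 B.1, ⟨A.2.1, B.2.1⟩, by simp [Form.FV, A.2.2, B.2.2]⟩

/-- `∀x A`, which is a sentence when `x`, and no other variable, is free in `A`. -/
def all {x : ℕ} (A : Form1 S x) (hx : x ∈ A.1.FV) : Sent S :=
  ⟨.all x A.1, ⟨hx, A.2.1⟩, Set.sdiff_eq_empty.mpr A.2.2⟩

/-- `∃x A`, which is a sentence when `x`, and no other variable, is free in `A`. -/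
def ex {x : ℕ} (A : Form1 S x) (hx : x ∈ A.1.FV) : Sent S :=
  ⟨.ex x A.1, ⟨hx, A.2.1⟩, Set.sdiff_eq_empty.mpr A.2.2⟩

/-- `A(c/x)`, as a sentence. -/
def inst {x : ℕ} (A : Form1 S x) (c : S.Const) : Sent S :=
  ⟨A.1.subst x c, Form.WF_subst x c A.1 A.2.1,
    (Form.FV_subst x c A.1).trans (Set.sdiff_eq_empty.mpr A.2.2)⟩

/-- The constant `c` occurs in the sentence `A`. -/
def Occurs (c : S.Const) (A : Sent S) : Prop := A.1.Occurs c

end Sent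

/-- Natural deduction for QFDE. `Deriv Γ A` says that there is a derivation tree with conclusion `A`
in which `Γ` is exactly the set of (undischarged) hypotheses on which the conclusion depends. -/
inductive Deriv {S : Signature.{u, v}} : Set (Sent S) → Sent S → Prop
  | hyp (A : Sent S) : Deriv {A} A
  | andI {Γ Δ : Set (Sent S)} {A B : Sent S} :
      Deriv Γ A → Deriv Δ B → Deriv (Γ ∪ Δ) (A.and B)
  | andE₁ {Γ : Set (Sent S)} {A B : Sent S} : Deriv Γ (A.and B) → Deriv Γ A
  | andE₂ {Γ : Set (Sent S)} {A B : Sent S} : Deriv Γ (A.and B) → Deriv Γ B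
  | orI₁ {Γ : Set (Sent S)} {A B : Sent S} : Deriv Γ A → Deriv Γ (A.or B)
  | orI₂ {Γ : Set (Sent S)} {A B : Sent S} : Deriv Γ B → Deriv Γ (A.or B)
  | orE {Γ Δ₁ Δ₂ : Set (Sent S)} {A B C : Sent S} :
      Deriv Γ (A.or B) → Deriv Δ₁ C → Deriv Δ₂ C →
      Deriv (Γ ∪ (Δ₁ \ {A}) ∪ (Δ₂ \ {B})) C
  | negAndI₁ {Γ : Set (Sent S)} {A B : Sent S} : Deriv Γ A.neg → Deriv Γ (A.and B).neg
  | negAndI₂ {Γ : Set (Sent S)} {A B : Sent S} : Deriv Γ B.neg → Deriv Γ (A.and B).neg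
  | negAndE {Γ Δ₁ Δ₂ : Set (Sent S)} {A B C : Sent S} :
      Deriv Γ (A.and B).neg → Deriv Δ₁ C → Deriv Δ₂ C →
      Deriv (Γ ∪ (Δ₁ \ {A.neg}) ∪ (Δ₂ \ {B.neg})) C
  | negOrI {Γ Δ : Set (Sent S)} {A B : Sent S} :
      Deriv Γ A.neg → Deriv Δ B.neg → Deriv (Γ ∪ Δ) (A.or B).neg
  | negOrE₁ {Γ : Set (Sent S)} {A B : Sent S} : Deriv Γ (A.or B).neg → Deriv Γ A.neg
  | negOrE₂ {Γ : Set (Sent S)} {A B : Sent S} : Deriv Γ (A.or B).neg → Deriv Γ B.neg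
  | dnI {Γ : Set (Sent S)} {A : Sent S} : Deriv Γ A → Deriv Γ A.neg.neg
  | dnE {Γ : Set (Sent S)} {A : Sent S} : Deriv Γ A.neg.neg → Deriv Γ A
  | allI {Γ : Set (Sent S)} {B : Sent S} {x : ℕ} {A : Form1 S x} (hx : x ∈ A.1.FV) (c : S.Const) :
      Deriv Γ (B.or (Sent.inst A c)) →
      ¬ A.1.Occurs c → ¬ B.Occurs c → (∀ H ∈ Γ, ¬ H.Occurs c) →
      Deriv Γ (B.or (Sent.all A hx))
  | allE {Γ : Set (Sent S)} {x : ℕ} {A : Form1 S x} (hx : x ∈ A.1.FV) (c : S.Const) :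
      Deriv Γ (Sent.all A hx) → Deriv Γ (Sent.inst A c)
  | exI {Γ : Set (Sent S)} {x : ℕ} {A : Form1 S x} (hx : x ∈ A.1.FV) (c : S.Const) :
      Deriv Γ (Sent.inst A c) → Deriv Γ (Sent.ex A hx)
  | exE {Γ Δ : Set (Sent S)} {C : Sent S} {x : ℕ} {A : Form1 S x} (hx : x ∈ A.1.FV) (c : S.Const) :
      Deriv Γ (Sent.ex A hx) → Deriv Δ C →
      ¬ A.1.Occurs c → ¬ C.Occurs c → (∀ H ∈ Δ \ {Sent.inst A c}, ¬ H.Occurs c) →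
      Deriv (Γ ∪ (Δ \ {Sent.inst A c})) C
  | negAllI {Γ : Set (Sent S)} {x : ℕ} {A : Form1 S x} (hx : x ∈ A.1.FV) (c : S.Const) :
      Deriv Γ (Sent.inst A c).neg → Deriv Γ (Sent.all A hx).neg
  | negAllE {Γ Δ : Set (Sent S)} {C : Sent S} {x : ℕ} {A : Form1 S x} (hx : x ∈ A.1.FV)
      (c : S.Const) :
      Deriv Γ (Sent.all A hx).neg → Deriv Δ C →
      ¬ A.1.Occurs c → ¬ C.Occurs c → (∀ H ∈ Δ \ {(Sent.inst A c).neg}, ¬ H.Occurs c) →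
      Deriv (Γ ∪ (Δ \ {(Sent.inst A c).neg})) C
  | negExI {Γ : Set (Sent S)} {x : ℕ} {A : Form1 S x} (hx : x ∈ A.1.FV) (c : S.Const) :
      Deriv Γ (Sent.inst A c).neg →
      ¬ A.1.Occurs c → (∀ H ∈ Γ, ¬ H.Occurs c) →
      Deriv Γ (Sent.ex A hx).neg
  | negExE {Γ : Set (Sent S)} {x : ℕ} {A : Form1 S x} (hx : x ∈ A.1.FV) (c : S.Const) :
      Deriv Γ (Sent.ex A hx).neg → Deriv Γ (Sent.inst A c).neg
  | eqI (c : S.Const) : Deriv ∅ (Sent.eq c c)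
  | eqE {Γ Δ : Set (Sent S)} {x : ℕ} {A : Form1 S x} {c₁ c₂ : S.Const} :
      Deriv Γ (Sent.eq c₁ c₂) → Deriv Δ (Sent.inst A c₁) → Deriv (Γ ∪ Δ) (Sent.inst A c₂)

/-- `Γ ⊢ A`: there is a derivation of `A` all of whose undischarged hypotheses belong to `Γ`. -/
def Provable {S : Signature.{u, v}} (Γ : Set (Sent S)) (A : Sent S) : Prop :=
  ∃ Γ₀ ⊆ Γ, Deriv Γ₀ A

/-- A structure: a non-empty domain, a denotation for each constant, and an extension and an
anti-extension for each predicate letter, the extension of the identity symbol being the identity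
relation on the domain (its anti-extension is arbitrary). -/
structure Struct (S : Signature.{u, v}) where
  Dom : Type w
  nonempty : Nonempty Dom
  den : S.Const → Dom
  ext : {n : ℕ} → S.Pred n → Set (Fin n → Dom)
  anti : {n : ℕ} → S.Pred n → Set (Fin n → Dom)
  ext_eq : ext S.eq = {p | p 0 = p 1}

/-- The signature obtained by adding a new constant `Sum.inr a` for each `a` in the set `D`. -/
@[reducible] def Signature.addConsts (S : Signature.{u, v}) (D : Type w) :
    Signature.{max u w, v} where
  Const := S.Const ⊕ D
  infinite := @Sum.infinite_of_left _ _ S.infinite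
  Pred := S.Pred
  eq := S.eq

/-- The inclusion of terms into those of the enlarged signature. -/
def Term.lift {S : Signature.{u, v}} (D : Type w) : Term S → Term (S.addConsts D)
  | .var x => .var x
  | .const c => .const (Sum.inl c)

/-- The inclusion of formulas into those of the enlarged signature. -/
def Form.lift {S : Signature.{u, v}} (D : Type w) : Form S → Form (S.addConsts D)
  | .atom P t => .atom (S := S.addConsts D) P fun i => (t i).lift D
  | .neg A => .neg (A.lift D)
  | .and A B => .and (A.lift D) (B.lift D)
  | .or A B => .or (A.lift D) (B.lift D)
  | .all x A => .all x (A.lift D)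
  | .ex x A => .ex x (A.lift D)

theorem Form.FV_lift {S : Signature.{u, v}} (D : Type w) (A : Form S) :
    (A.lift D).FV = A.FV := by
  induction A with
  | atom P t =>
    ext x
    simp only [Form.lift, Form.FV, Set.mem_ofPred_eq]
    refine exists_congr fun i => ?_
    cases t i <;> simp [Term.lift]
  | neg A ih => simpa [Form.lift, Form.FV] using ih
  | and A B ihA ihB => simp only [Form.lift, Form.FV, ihA, ihB]
  | or A B ihA ihB => simp only [Form.lift, Form.FV, ihA, ihB]
  | all y A ih => simp only [Form.lift, Form.FV, ih]
  | ex y A ih => simp only [Form.lift, Form.FV, ih]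

theorem Form.WF_lift {S : Signature.{u, v}} (D : Type w) (A : Form S) (hA : A.WF) :
    (A.lift D).WF := by
  induction A with
  | atom P t => trivial
  | neg A ih => exact ih hA
  | and A B ihA ihB => exact ⟨ihA hA.1, ihB hA.2⟩
  | or A B ihA ihB => exact ⟨ihA hA.1, ihB hA.2⟩
  | all y A ih => exact ⟨(Form.FV_lift D A).symm ▸ hA.1, ih hA.2⟩
  | ex y A ih => exact ⟨(Form.FV_lift D A).symm ▸ hA.1, ih hA.2⟩

/-- The inclusion of sentences into those of the enlarged signature. -/
def Sent.lift {S : Signature.{u, v}} (D : Type w) (A : Sent S) : Sent (S.addConsts D) :=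
  ⟨A.1.lift D, A.1.WF_lift D A.2.1, (A.1.FV_lift D).trans A.2.2⟩

namespace Struct

variable {S : Signature.{u, v}}

/-- The diagram signature of `𝔄`: a new constant (a name) for each element of the domain. -/
abbrev diagram (𝔄 : Struct.{u, v, w} S) : Signature.{max u w, v} := S.addConsts 𝔄.Dom

/-- The constant of the diagram signature that names `a`. -/
def name (𝔄 : Struct.{u, v, w} S) (a : 𝔄.Dom) : 𝔄.diagram.Const := Sum.inr a

/-- The structure for the diagram signature that is like `𝔄` and in which `name a` denotes `a`. -/
def hat (𝔄 : Struct.{u, v, w} S) : Struct.{max u w, v, w} 𝔄.diagram where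
  Dom := 𝔄.Dom
  nonempty := 𝔄.nonempty
  den := Sum.elim 𝔄.den id
  ext := 𝔄.ext
  anti := 𝔄.anti
  ext_eq := 𝔄.ext_eq

/-- `v` is a valuation induced by `𝔄`: a map from the sentences of the diagram language to the two
values `true` (for 1) and `false` (for 0) that satisfies the semantic clauses. -/
structure IsInducedValuation (𝔄 : Struct.{u, v, w} S) (v : Sent 𝔄.diagram → Bool) : Prop where
  atom : ∀ {n : ℕ} (P : 𝔄.diagram.Pred n) (c : Fin n → 𝔄.diagram.Const),
    v (Sent.atom P c) = true ↔ (fun i => 𝔄.hat.den (c i)) ∈ 𝔄.ext P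
  neg_atom : ∀ {n : ℕ} (P : 𝔄.diagram.Pred n) (c : Fin n → 𝔄.diagram.Const),
    v (Sent.atom P c).neg = true ↔ (fun i => 𝔄.hat.den (c i)) ∈ 𝔄.anti P
  and : ∀ A B : Sent 𝔄.diagram, v (A.and B) = true ↔ v A = true ∧ v B = true
  or : ∀ A B : Sent 𝔄.diagram, v (A.or B) = true ↔ v A = true ∨ v B = true
  neg_and : ∀ A B : Sent 𝔄.diagram,
    v (A.and B).neg = true ↔ v A.neg = true ∨ v B.neg = true
  neg_or : ∀ A B : Sent 𝔄.diagram,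
    v (A.or B).neg = true ↔ v A.neg = true ∧ v B.neg = true
  neg_neg : ∀ A : Sent 𝔄.diagram, v A.neg.neg = true ↔ v A = true
  all : ∀ {x : ℕ} (A : Form1 𝔄.diagram x) (hx : x ∈ A.1.FV),
    v (Sent.all A hx) = true ↔ ∀ a : 𝔄.Dom, v (Sent.inst A (𝔄.name a)) = true
  ex : ∀ {x : ℕ} (A : Form1 𝔄.diagram x) (hx : x ∈ A.1.FV),
    v (Sent.ex A hx) = true ↔ ∃ a : 𝔄.Dom, v (Sent.inst A (𝔄.name a)) = true
  neg_all : ∀ {x : ℕ} (A : Form1 𝔄.diagram x) (hx : x ∈ A.1.FV),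
    v (Sent.all A hx).neg = true ↔ ∃ a : 𝔄.Dom, v (Sent.inst A (𝔄.name a)).neg = true
  neg_ex : ∀ {x : ℕ} (A : Form1 𝔄.diagram x) (hx : x ∈ A.1.FV),
    v (Sent.ex A hx).neg = true ↔ ∀ a : 𝔄.Dom, v (Sent.inst A (𝔄.name a)).neg = true

/-- `A` holds in `𝔄`: the valuation induced by `𝔄` gives `A` the value 1. -/
def Holds (𝔄 : Struct.{u, v, w} S) (A : Sent S) : Prop :=
  ∃ v : Sent 𝔄.diagram → Bool, 𝔄.IsInducedValuation v ∧ v (A.lift 𝔄.Dom) = true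

end Struct

/-- `Γ ⊨ A`: `A` holds in every structure (with domain in the universe `w`) in which every element
of `Γ` holds. -/
def Entails {S : Signature.{u, v}} (Γ : Set (Sent S)) (A : Sent S) : Prop :=
  ∀ 𝔄 : Struct.{u, v, w} S, (∀ B ∈ Γ, 𝔄.Holds B) → 𝔄.Holds A

end QFDE

/-!
Truth in a structure is computed by a Tarskian recursion `Struct.Sat`, which treats the truth of `A`
and the truth of `¬A` side by side, as the clauses for negated compounds require. It gives an induced
valuation (`Struct.isInducedValuation_sat`), and induction on sentences, with the instances of a
quantified sentence as its immediate parts, shows that there is no other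
(`Struct.IsInducedValuation.unique`). Hence `𝔄.Holds` is satisfaction (`Struct.holds_iff_sat`), and
soundness is an induction on derivations, in which the denotation of an eigenconstant is varied.

Completeness is a Henkin argument. New constants are conservative (`Provable.of_lift`), since
derivability is preserved by arbitrary, not only injective, renamings of constants: eigenconstants
can be chosen afresh while the renaming proceeds through the derivation (`Deriv.map`).

In the language with new constants, a pair `(T, F)` is consistent if `T` derives no disjunction of
members of `F`. Starting from `(Γ, {A₀})`, the sentences are put one after the other, along a
well-order, into `T` or into `F`. An accepted existential sentence is accepted together with an
instance for a fresh constant, by `∃E`; a rejected universal sentence is rejected together with an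
instance for a fresh constant. The latter is the point of the side formula `B` in the rule `∀I`,
from `B ∨ A(c)` to `B ∨ ∀x A`: `B` is the disjunction of what has been rejected before. Negated
quantifiers behave dually. There are enough new constants for this, as the initial segments of a
well-order of minimal type are smaller than the whole (`exists_fresh_choice`), and consistency
survives at limits by compactness. The accepted sentences then form a saturated theory
(`exists_saturated`), and its constants, up to provable identity, form a model in which exactly the
members of the theory are true (`Saturated.sat_model_iff`).
-/

namespace QFDE

universe u' v'

/-! ### Renaming of constants -/

/-- A translation of one signature into another: it sends constants to constants (not necessarily
injectively) and predicate letters to predicate letters of the same arity, and preserves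
identity. -/
structure Renaming (S : Signature.{u, v}) (S' : Signature.{u', v'}) where
  const : S.Const → S'.Const
  pred : {n : ℕ} → S.Pred n → S'.Pred n
  pred_eq : pred S.eq = S'.eq

variable {S : Signature.{u, v}} {S' : Signature.{u', v'}}

open Classical in
/-- The renaming that agrees with `φ` except that it sends `c` to `d`. -/
noncomputable def Renaming.update (φ : Renaming S S') (c : S.Const) (d : S'.Const) :
    Renaming S S' where
  const := Function.update φ.const c d
  pred := φ.pred
  pred_eq := φ.pred_eq

/-- The inclusion of a signature into its extension by new constants. -/
def Renaming.inclusion (S : Signature.{u, v}) (D : Type w) : Renaming S (S.addConsts D) where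
  const := Sum.inl
  pred := id
  pred_eq := rfl

/-- The action of a renaming on terms. -/
def Term.map (φ : Renaming S S') : Term S → Term S'
  | .var x => .var x
  | .const c => .const (φ.const c)

namespace Form

/-- The action of a renaming on formulas. -/
def map (φ : Renaming S S') : Form S → Form S'
  | atom P t => atom (φ.pred P) fun i => (t i).map φ
  | neg A => neg (A.map φ)
  | and A B => and (A.map φ) (B.map φ)
  | or A B => or (A.map φ) (B.map φ)
  | all x A => all x (A.map φ)
  | ex x A => ex x (A.map φ)

theorem FV_map (φ : Renaming S S') (A : Form S) : (A.map φ).FV = A.FV := by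
  induction A with
  | atom P t =>
    ext x
    simp only [map, FV, Set.mem_ofPred_eq]
    refine exists_congr fun i => ?_
    cases t i <;> simp [Term.map]
  | _ => simp_all [map, FV]

theorem WF_map (φ : Renaming S S') {A : Form S} (hA : A.WF) : (A.map φ).WF := by
  induction A with
  | atom P t => trivial
  | _ => simp_all [map, WF, FV_map]

theorem map_subst (φ : Renaming S S') (x : ℕ) (c : S.Const) (A : Form S) :
    (A.subst x c).map φ = (A.map φ).subst x (φ.const c) := by
  induction A with
  | atom P t =>
    simp only [subst, map, atom.injEq, heq_eq_eq, true_and]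
    funext i
    cases t i with
    | var y => by_cases h : y = x <;> simp [Term.subst, Term.map, h]
    | const d => rfl
  | all y A ih => by_cases h : y = x <;> simp [subst, map, h, ih]
  | ex y A ih => by_cases h : y = x <;> simp [subst, map, h, ih]
  | _ => simp_all [map, subst]

theorem map_update (φ : Renaming S S') {c : S.Const} (d : S'.Const) {A : Form S}
    (h : ¬ A.Occurs c) : A.map (φ.update c d) = A.map φ := by
  induction A with
  | atom P t =>
    simp only [map, Renaming.update, atom.injEq, heq_eq_eq, true_and]
    funext i
    cases hi : t i with
    | var y => rfl
    | const e =>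
      have : e ≠ c := fun he => h ⟨i, he ▸ hi⟩
      simp [Term.map, this]
  | _ => simp_all [map, Occurs]

theorem lift_eq_map (D : Type w) (A : Form S) :
    A.lift D = A.map (Renaming.inclusion S D) := by
  induction A with
  | atom P t =>
    simp only [lift, map, Renaming.inclusion, id, atom.injEq, heq_eq_eq, true_and]
    funext i
    cases t i <;> rfl
  | _ => simp_all [map, lift]

theorem map_lift {D : Type w} {φ : Renaming (S.addConsts D) S}
    (hc : ∀ c, φ.const (Sum.inl c) = c) (hp : ∀ {n} (P : S.Pred n), φ.pred P = P) (A : Form S) :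
    (A.lift D).map φ = A := by
  induction A with
  | atom P t =>
    simp only [lift, map, hp, atom.injEq, heq_eq_eq, true_and]
    funext i
    cases t i <;> simp [Term.lift, Term.map, hc]
  | _ => simp_all [map, lift]

theorem finite_occurs (A : Form S) : {c | A.Occurs c}.Finite := by
  induction A with
  | atom P t =>
    refine (Set.finite_range fun i => t i).preimage
      (f := Term.const) (fun a _ b _ h => Term.const.inj h) |>.subset ?_
    rintro c ⟨i, hi⟩
    exact ⟨i, hi⟩
  | neg A ih => exact ih
  | and A B ihA ihB => exact ihA.union ihB
  | or A B ihA ihB => exact ihA.union ihB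
  | all x A ih => exact ih
  | ex x A ih => exact ih

theorem occurs_of_occurs_subst {x : ℕ} {c d : S.Const} {A : Form S}
    (h : (A.subst x c).Occurs d) : A.Occurs d ∨ d = c := by
  induction A with
  | atom P t =>
    obtain ⟨i, hi⟩ := h
    change (t i).subst x c = Term.const d at hi
    cases ht : t i with
    | var y =>
      rw [ht] at hi
      simp only [Term.subst] at hi
      split_ifs at hi
      exact Or.inr (Term.const.inj hi).symm
    | const e =>
      rw [ht] at hi
      exact Or.inl ⟨i, ht.trans hi⟩
  | neg A ih => exact ih h
  | and A B ihA ihB =>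
    rcases h with h | h
    · exact (ihA h).imp_left Or.inl
    · exact (ihB h).imp_left Or.inr
  | or A B ihA ihB =>
    rcases h with h | h
    · exact (ihA h).imp_left Or.inl
    · exact (ihB h).imp_left Or.inr
  | all y A ih =>
    by_cases hy : y = x
    · exact Or.inl (by simpa [subst, hy] using h)
    · exact ih (by simpa [subst, hy, Occurs] using h)
  | ex y A ih =>
    by_cases hy : y = x
    · exact Or.inl (by simpa [subst, hy] using h)
    · exact ih (by simpa [subst, hy, Occurs] using h)

theorem not_occurs_lift {D : Type w} (a : D) (A : Form S) :
    ¬ (A.lift D).Occurs (Sum.inr a) := by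
  induction A with
  | atom P t =>
    rintro ⟨i, hi⟩
    cases h : t i <;> simp [h, Term.lift] at hi
  | _ => simp_all [lift, Occurs]

end Form

namespace Sent

/-- The action of a renaming on sentences. -/
def map (φ : Renaming S S') (A : Sent S) : Sent S' :=
  ⟨A.1.map φ, A.1.WF_map φ A.2.1, (A.1.FV_map φ).trans A.2.2⟩

theorem map_update (φ : Renaming S S') {c : S.Const} (d : S'.Const) {A : Sent S}
    (h : ¬ A.Occurs c) : A.map (φ.update c d) = A.map φ :=
  Subtype.ext (Form.map_update φ d h)

theorem image_map_update (φ : Renaming S S') {c : S.Const} (d : S'.Const) {Γ : Set (Sent S)}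
    (h : ∀ H ∈ Γ, ¬ H.Occurs c) : map (φ.update c d) '' Γ = map φ '' Γ :=
  Set.image_congr fun H hH => map_update φ d (h H hH)

end Sent

/-- The action of a renaming on formulas with at most `x` free. -/
def Form1.map {x : ℕ} (φ : Renaming S S') (A : Form1 S x) : Form1 S' x :=
  ⟨A.1.map φ, A.1.WF_map φ A.2.1, (A.1.FV_map φ).trans_subset A.2.2⟩

theorem Sent.map_inst {x : ℕ} (φ : Renaming S S') (A : Form1 S x) (c : S.Const) :
    (Sent.inst A c).map φ = Sent.inst (A.map φ) (φ.const c) :=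
  Subtype.ext (Form.map_subst φ x c A.1)

theorem Sent.map_eq (φ : Renaming S S') (c d : S.Const) :
    (Sent.eq c d).map φ = Sent.eq (φ.const c) (φ.const d) := by
  refine Subtype.ext ?_
  simp only [Sent.map, Sent.eq, Sent.atom, Form.map, φ.pred_eq, Form.atom.injEq, heq_eq_eq,
    true_and]
  funext i
  fin_cases i <;> rfl

theorem Sent.map_update_inst {x : ℕ} (φ : Renaming S S') {c : S.Const} (d : S'.Const)
    {A : Form1 S x} (h : ¬ A.1.Occurs c) :
    (Sent.inst A c).map (φ.update c d) = Sent.inst (A.map φ) d := by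
  rw [Sent.map_inst]
  have : A.map (φ.update c d) = A.map φ := Subtype.ext (Form.map_update φ d h)
  rw [this]
  simp [Renaming.update]

theorem exists_fresh {X : Set (Form S)} (hX : X.Finite) : ∃ c, ∀ A ∈ X, ¬ A.Occurs c := by
  have : Infinite S.Const := S.infinite
  obtain ⟨c, hc⟩ := (hX.biUnion fun A _ => A.finite_occurs).exists_notMem
  exact ⟨c, fun A hA h => hc (Set.mem_biUnion hA h)⟩

/-! ### Derivability from an arbitrary set of hypotheses -/

theorem Deriv.finite {Γ : Set (Sent S)} {A : Sent S} (h : Deriv Γ A) : Γ.Finite := by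
  induction h with
  | hyp => exact Set.finite_singleton _
  | eqI => exact Set.finite_empty
  | orE _ _ _ h h₁ h₂ | negAndE _ _ _ h h₁ h₂ => exact (h.union h₁.sdiff).union h₂.sdiff
  | exE _ _ _ _ _ _ _ h h₁ | negAllE _ _ _ _ _ _ _ h h₁ => exact h.union h₁.sdiff
  | andI _ _ h h₁ | negOrI _ _ h h₁ | eqE _ _ h h₁ => exact h.union h₁
  | _ => assumption

namespace Provable

variable {Γ Δ : Set (Sent S)} {A B C D : Sent S}

theorem mono (hΓ : Γ ⊆ Δ) : Provable Γ A → Provable Δ A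
  | ⟨Γ₀, h₀, h⟩ => ⟨Γ₀, h₀.trans hΓ, h⟩

theorem of_mem (h : A ∈ Γ) : Provable Γ A := ⟨{A}, Set.singleton_subset_iff.2 h, .hyp A⟩

theorem andI : Provable Γ A → Provable Γ B → Provable Γ (A.and B)
  | ⟨_, h₁, d₁⟩, ⟨_, h₂, d₂⟩ => ⟨_, Set.union_subset h₁ h₂, d₁.andI d₂⟩

theorem negOrI : Provable Γ A.neg → Provable Γ B.neg → Provable Γ (A.or B).neg
  | ⟨_, h₁, d₁⟩, ⟨_, h₂, d₂⟩ => ⟨_, Set.union_subset h₁ h₂, d₁.negOrI d₂⟩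

theorem eqI (c : S.Const) : Provable Γ (Sent.eq c c) := ⟨∅, Set.empty_subset _, .eqI c⟩

theorem eqE {x : ℕ} {A : Form1 S x} {c₁ c₂ : S.Const} :
    Provable Γ (Sent.eq c₁ c₂) → Provable Γ (Sent.inst A c₁) → Provable Γ (Sent.inst A c₂)
  | ⟨_, h₁, d₁⟩, ⟨_, h₂, d₂⟩ => ⟨_, Set.union_subset h₁ h₂, d₁.eqE d₂⟩

/-- Rules with one premise, and without discharge or side condition, apply to derivability from
any set. -/
theorem lift₁ (f : ∀ {Γ}, Deriv Γ A → Deriv Γ B) : Provable Γ A → Provable Γ B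
  | ⟨Γ₀, h₀, h⟩ => ⟨Γ₀, h₀, f h⟩

theorem orE : Provable Γ (A.or B) → Provable (insert A Γ) C → Provable (insert B Γ) C →
    Provable Γ C
  | ⟨_, h, d⟩, ⟨_, h₁, d₁⟩, ⟨_, h₂, d₂⟩ =>
    ⟨_, Set.union_subset (Set.union_subset h (Set.sdiff_singleton_subset_iff.2 h₁))
      (Set.sdiff_singleton_subset_iff.2 h₂), d.orE d₁ d₂⟩

theorem negAndE : Provable Γ (A.and B).neg → Provable (insert A.neg Γ) C →
    Provable (insert B.neg Γ) C → Provable Γ C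
  | ⟨_, h, d⟩, ⟨_, h₁, d₁⟩, ⟨_, h₂, d₂⟩ =>
    ⟨_, Set.union_subset (Set.union_subset h (Set.sdiff_singleton_subset_iff.2 h₁))
      (Set.sdiff_singleton_subset_iff.2 h₂), d.negAndE d₁ d₂⟩

theorem cut (h : Provable Γ A) (h' : Provable (insert A Γ) B) : Provable Γ B :=
  orE (h.lift₁ .orI₁) h' h'

theorem trans (h : Provable Γ A) (h' : Provable {A} B) : Provable Γ B :=
  h.cut (h'.mono (by simp))

section Quantifiers

variable {x : ℕ} {E : Form1 S x} (hx : x ∈ E.1.FV) {c : S.Const}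

theorem allI (hE : ¬ E.1.Occurs c) (hB : ¬ B.Occurs c) (hΓ : ∀ H ∈ Γ, ¬ H.Occurs c) :
    Provable Γ (B.or (Sent.inst E c)) → Provable Γ (B.or (Sent.all E hx))
  | ⟨_, h, d⟩ => ⟨_, h, d.allI hx c hE hB fun H hH => hΓ H (h hH)⟩

theorem negExI (hE : ¬ E.1.Occurs c) (hΓ : ∀ H ∈ Γ, ¬ H.Occurs c) :
    Provable Γ (Sent.inst E c).neg → Provable Γ (Sent.ex E hx).neg
  | ⟨_, h, d⟩ => ⟨_, h, d.negExI hx c hE fun H hH => hΓ H (h hH)⟩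

theorem exE (hE : ¬ E.1.Occurs c) (hC : ¬ C.Occurs c) (hΓ : ∀ H ∈ Γ, ¬ H.Occurs c) :
    Provable Γ (Sent.ex E hx) → Provable (insert (Sent.inst E c) Γ) C → Provable Γ C
  | ⟨_, h, d⟩, ⟨_, h₁, d₁⟩ =>
    have h₁ := Set.sdiff_singleton_subset_iff.2 h₁
    ⟨_, Set.union_subset h h₁, d.exE hx c d₁ hE hC fun H hH => hΓ H (h₁ hH)⟩

theorem negAllE (hE : ¬ E.1.Occurs c) (hC : ¬ C.Occurs c) (hΓ : ∀ H ∈ Γ, ¬ H.Occurs c) :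
    Provable Γ (Sent.all E hx).neg → Provable (insert (Sent.inst E c).neg Γ) C → Provable Γ C
  | ⟨_, h, d⟩, ⟨_, h₁, d₁⟩ =>
    have h₁ := Set.sdiff_singleton_subset_iff.2 h₁
    ⟨_, Set.union_subset h h₁, d.negAllE hx c d₁ hE hC fun H hH => hΓ H (h₁ hH)⟩

end Quantifiers

end Provable

theorem image_subset_insert_of_sdiff_subset {α β : Type*} {f : α → β} {s t : Set α} {a : α}
    (h : s \ {a} ⊆ t) : f '' s ⊆ insert (f a) (f '' t) := by
  rw [← Set.image_insert_eq]
  exact Set.image_mono (Set.sdiff_singleton_subset_iff.1 h)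

/-- Derivability is preserved by every renaming of the constants, injective or not: at a rule with
an eigenconstant `c`, the renaming of the subderivation is changed so that it sends `c` to a
constant that is fresh for the renamed conclusion. -/
theorem Deriv.map {Γ : Set (Sent S)} {A : Sent S} (h : Deriv Γ A) (φ : Renaming S S') :
    Provable (Sent.map φ '' Γ) (A.map φ) := by
  induction h generalizing φ with
  | hyp A => exact .of_mem (Set.mem_image_of_mem _ rfl)
  | @andI Γ Δ A B _ _ ih₁ ih₂ =>
    exact .andI ((ih₁ φ).mono (Set.image_mono Set.subset_union_left))
      ((ih₂ φ).mono (Set.image_mono Set.subset_union_right))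
  | @andE₁ Γ A B _ ih => exact (ih φ).lift₁ (.andE₁ (B := B.map φ))
  | @andE₂ Γ A B _ ih => exact (ih φ).lift₁ (.andE₂ (A := A.map φ))
  | @orI₁ Γ A B _ ih => exact (ih φ).lift₁ (.orI₁ (B := B.map φ))
  | @orI₂ Γ A B _ ih => exact (ih φ).lift₁ (.orI₂ (A := A.map φ))
  | @orE Γ Δ₁ Δ₂ A B C _ _ _ ih ih₁ ih₂ =>
    refine .orE (A := A.map φ) (B := B.map φ) ((ih φ).mono (Set.image_mono ?_))
      ((ih₁ φ).mono (image_subset_insert_of_sdiff_subset ?_))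
      ((ih₂ φ).mono (image_subset_insert_of_sdiff_subset ?_))
    · exact Set.subset_union_left.trans Set.subset_union_left
    · exact Set.subset_union_right.trans Set.subset_union_left
    · exact Set.subset_union_right
  | @negAndI₁ Γ A B _ ih => exact (ih φ).lift₁ (.negAndI₁ (A := A.map φ) (B := B.map φ))
  | @negAndI₂ Γ A B _ ih => exact (ih φ).lift₁ (.negAndI₂ (A := A.map φ) (B := B.map φ))
  | @negAndE Γ Δ₁ Δ₂ A B C _ _ _ ih ih₁ ih₂ =>
    refine .negAndE (A := A.map φ) (B := B.map φ) ((ih φ).mono (Set.image_mono ?_))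
      ((ih₁ φ).mono (image_subset_insert_of_sdiff_subset (a := A.neg) ?_))
      ((ih₂ φ).mono (image_subset_insert_of_sdiff_subset (a := B.neg) ?_))
    · exact Set.subset_union_left.trans Set.subset_union_left
    · exact Set.subset_union_right.trans Set.subset_union_left
    · exact Set.subset_union_right
  | @negOrI Γ Δ A B _ _ ih₁ ih₂ =>
    exact .negOrI (A := A.map φ) (B := B.map φ)
      ((ih₁ φ).mono (Set.image_mono Set.subset_union_left))
      ((ih₂ φ).mono (Set.image_mono Set.subset_union_right))
  | @negOrE₁ Γ A B _ ih => exact (ih φ).lift₁ (.negOrE₁ (A := A.map φ) (B := B.map φ))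
  | @negOrE₂ Γ A B _ ih => exact (ih φ).lift₁ (.negOrE₂ (A := A.map φ) (B := B.map φ))
  | @dnI Γ A _ ih => exact (ih φ).lift₁ (.dnI (A := A.map φ))
  | @dnE Γ A _ ih => exact (ih φ).lift₁ (.dnE (A := A.map φ))
  | @allI Γ B x A hx c d hA hB hΓ ih =>
    obtain ⟨e, he⟩ := exists_fresh (S := S')
      (((d.finite.image fun H => H.1.map φ).insert (B.1.map φ)).insert (A.1.map φ))
    have ih := ih (φ.update c e)
    rw [Sent.image_map_update φ e hΓ] at ih
    change Provable _ ((B.map (φ.update c e)).or ((Sent.inst A c).map (φ.update c e))) at ih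
    rw [Sent.map_update φ e hB, Sent.map_update_inst φ e hA] at ih
    refine ih.allI (E := A.map φ) (by simpa [Form1.map, Form.FV_map] using hx)
      (he _ (Set.mem_insert _ _)) (he _ (by simp [Sent.map])) ?_
    rintro _ ⟨H, hH, rfl⟩
    exact he _ (by right; right; exact ⟨H, hH, rfl⟩)
  | @allE Γ x A hx c _ ih =>
    rw [Sent.map_inst]
    exact (ih φ).lift₁ (.allE (A := A.map φ) (by simpa [Form1.map, Form.FV_map] using hx) _)
  | @exI Γ x A hx c _ ih =>
    have ih := ih φ
    rw [Sent.map_inst] at ih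
    exact ih.lift₁ (.exI (A := A.map φ) (by simpa [Form1.map, Form.FV_map] using hx) _)
  | @exE Γ Δ C x A hx c d₁ d₂ hA hC hΔ ih₁ ih₂ =>
    obtain ⟨e, he⟩ := exists_fresh (S := S')
      ((((d₁.exE hx c d₂ hA hC hΔ).finite.image fun H => H.1.map φ).insert
        (C.1.map φ)).insert (A.1.map φ))
    have ih := (ih₂ (φ.update c e)).mono (image_subset_insert_of_sdiff_subset
      (a := Sent.inst A c) subset_rfl)
    rw [Sent.image_map_update φ e hΔ, Sent.map_update φ e hC, Sent.map_update_inst φ e hA] at ih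
    refine .exE (E := A.map φ) (by simpa [Form1.map, Form.FV_map] using hx)
      (he _ (Set.mem_insert _ _)) (he _ (by simp [Sent.map])) ?_
      ((ih₁ φ).mono (Set.image_mono Set.subset_union_left))
      (ih.mono (Set.insert_subset_insert (Set.image_mono Set.subset_union_right)))
    rintro _ ⟨H, hH, rfl⟩
    exact he _ (by right; right; exact ⟨H, hH, rfl⟩)
  | @negAllI Γ x A hx c _ ih =>
    have ih := ih φ
    change Provable _ ((Sent.inst A c).map φ).neg at ih
    rw [Sent.map_inst] at ih
    exact ih.lift₁ (.negAllI (A := A.map φ) (by simpa [Form1.map, Form.FV_map] using hx) _)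
  | @negAllE Γ Δ C x A hx c d₁ d₂ hA hC hΔ ih₁ ih₂ =>
    obtain ⟨e, he⟩ := exists_fresh (S := S')
      ((((d₁.negAllE hx c d₂ hA hC hΔ).finite.image fun H => H.1.map φ).insert
        (C.1.map φ)).insert (A.1.map φ))
    have ih := (ih₂ (φ.update c e)).mono (image_subset_insert_of_sdiff_subset
      (a := (Sent.inst A c).neg) subset_rfl)
    change Provable (insert ((Sent.inst A c).map (φ.update c e)).neg _) _ at ih
    rw [Sent.image_map_update φ e hΔ, Sent.map_update φ e hC, Sent.map_update_inst φ e hA] at ih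
    refine .negAllE (E := A.map φ) (by simpa [Form1.map, Form.FV_map] using hx)
      (he _ (Set.mem_insert _ _)) (he _ (by simp [Sent.map])) ?_
      ((ih₁ φ).mono (Set.image_mono Set.subset_union_left))
      (ih.mono (Set.insert_subset_insert (Set.image_mono Set.subset_union_right)))
    rintro _ ⟨H, hH, rfl⟩
    exact he _ (by right; right; exact ⟨H, hH, rfl⟩)
  | @negExI Γ x A hx c d hA hΓ ih =>
    obtain ⟨e, he⟩ := exists_fresh (S := S')
      ((d.finite.image fun H => H.1.map φ).insert (A.1.map φ))
    have ih := ih (φ.update c e)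
    rw [Sent.image_map_update φ e hΓ] at ih
    change Provable _ ((Sent.inst A c).map (φ.update c e)).neg at ih
    rw [Sent.map_update_inst φ e hA] at ih
    refine ih.negExI (E := A.map φ) (by simpa [Form1.map, Form.FV_map] using hx)
      (he _ (Set.mem_insert _ _)) ?_
    rintro _ ⟨H, hH, rfl⟩
    exact he _ (by right; exact ⟨H, hH, rfl⟩)
  | @negExE Γ x A hx c _ ih =>
    change Provable _ ((Sent.inst A c).map φ).neg
    rw [Sent.map_inst]
    exact (ih φ).lift₁ (.negExE (A := A.map φ) (by simpa [Form1.map, Form.FV_map] using hx) _)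
  | eqI c =>
    rw [Sent.map_eq]
    exact .eqI _
  | @eqE Γ Δ x A c₁ c₂ _ _ ih₁ ih₂ =>
    have ih₁ := ih₁ φ
    have ih₂ := ih₂ φ
    rw [Sent.map_eq] at ih₁
    rw [Sent.map_inst] at ih₂ ⊢
    exact .eqE (ih₁.mono (Set.image_mono Set.subset_union_left))
      (ih₂.mono (Set.image_mono Set.subset_union_right))

/-- New constants are conservative: they can be renamed to old ones. -/
theorem Provable.of_lift {D : Type w} {Γ : Set (Sent S)} {A : Sent S}
    (h : Provable (Sent.lift D '' Γ) (A.lift D)) : Provable Γ A := by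
  obtain ⟨c⟩ : Nonempty S.Const := @Infinite.nonempty _ S.infinite
  let φ : Renaming (S.addConsts D) S :=
    { const := Sum.elim id fun _ => c, pred := id, pred_eq := rfl }
  have hφ (B : Sent S) : (B.lift D).map φ = B :=
    Subtype.ext (Form.map_lift (φ := φ) (fun _ => rfl) (fun _ => rfl) B.1)
  obtain ⟨Γ₀, h₀, d⟩ := h
  have := (d.map φ).mono (Set.image_mono h₀)
  simpa [Set.image_image, hφ] using this

/-! ### Induction on sentences -/

/-- The number of connectives and quantifiers. -/
def Form.size : Form S → ℕ
  | atom _ _ => 0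
  | neg A => A.size + 1
  | and A B => A.size + B.size + 1
  | or A B => A.size + B.size + 1
  | all _ A => A.size + 1
  | ex _ A => A.size + 1

theorem Form.size_subst (x : ℕ) (c : S.Const) (A : Form S) : (A.subst x c).size = A.size := by
  induction A with
  | atom P t => rfl
  | all y A ih => by_cases h : y = x <;> simp [subst, size, h, ih]
  | ex y A ih => by_cases h : y = x <;> simp [subst, size, h, ih]
  | _ => simp_all [subst, size]

/-- Induction on sentences, where the immediate subsentences of a quantified sentence are its
instances. -/
theorem Sent.induction {p : Sent S → Prop}
    (atom : ∀ {n : ℕ} (P : S.Pred n) (c : Fin n → S.Const), p (Sent.atom P c))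
    (neg : ∀ A, p A → p A.neg)
    (and : ∀ A B, p A → p B → p (A.and B))
    (or : ∀ A B, p A → p B → p (A.or B))
    (all : ∀ {x : ℕ} (A : Form1 S x) (hx : x ∈ A.1.FV), (∀ c, p (Sent.inst A c)) →
      p (Sent.all A hx))
    (ex : ∀ {x : ℕ} (A : Form1 S x) (hx : x ∈ A.1.FV), (∀ c, p (Sent.inst A c)) →
      p (Sent.ex A hx))
    (A : Sent S) : p A := by
  suffices H : ∀ (k : ℕ) (A : Sent S), A.1.size < k → p A from H _ A (Nat.lt_succ_self _)
  intro k
  induction k with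
  | zero => intro A hA; exact absurd hA (Nat.not_lt_zero _)
  | succ k ih =>
    rintro ⟨A, hwf, hfv⟩ hA
    cases A with
    | atom P t =>
      have h (i) : ∃ c, t i = Term.const c := by
        cases hi : t i with
        | var x => exact absurd (show x ∈ (∅ : Set ℕ) from hfv ▸ ⟨i, hi⟩) (Set.notMem_empty x)
        | const c => exact ⟨c, rfl⟩
      choose c hc using h
      obtain rfl : t = fun i => Term.const (c i) := funext hc
      exact atom P c
    | neg A =>
      simp only [Form.size] at hA
      exact neg ⟨A, hwf, hfv⟩ (ih _ (by simp only; omega))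
    | and A B =>
      simp only [Form.size] at hA
      obtain ⟨hA', hB'⟩ := Set.union_empty_iff.1 hfv
      exact and ⟨A, hwf.1, hA'⟩ ⟨B, hwf.2, hB'⟩ (ih _ (by simp only; omega))
        (ih _ (by simp only; omega))
    | or A B =>
      simp only [Form.size] at hA
      obtain ⟨hA', hB'⟩ := Set.union_empty_iff.1 hfv
      exact or ⟨A, hwf.1, hA'⟩ ⟨B, hwf.2, hB'⟩ (ih _ (by simp only; omega))
        (ih _ (by simp only; omega))
    | all x A =>
      simp only [Form.size] at hA
      refine all ⟨A, hwf.2, Set.sdiff_eq_empty.1 hfv⟩ hwf.1 fun c => ih _ ?_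
      simp only [Sent.inst, Form.size_subst]
      omega
    | ex x A =>
      simp only [Form.size] at hA
      refine ex ⟨A, hwf.2, Set.sdiff_eq_empty.1 hfv⟩ hwf.1 fun c => ih _ ?_
      simp only [Sent.inst, Form.size_subst]
      omega

/-! ### Satisfaction and induced valuations -/

namespace Struct

/-- The value of a term under an assignment `s` to the variables. -/
def termVal (𝔄 : Struct.{u, v, w} S) (s : ℕ → 𝔄.Dom) : Term S → 𝔄.Dom
  | .var x => s x
  | .const c => 𝔄.den c

/-- Tarskian satisfaction under an assignment: `𝔄.Sat A true s` says that `A` is true, and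
`𝔄.Sat A false s` that `¬A` is true (`A` may be both, or neither). -/
def Sat (𝔄 : Struct.{u, v, w} S) : Form S → Bool → (ℕ → 𝔄.Dom) → Prop
  | .atom P t, true, s => (fun i => 𝔄.termVal s (t i)) ∈ 𝔄.ext P
  | .atom P t, false, s => (fun i => 𝔄.termVal s (t i)) ∈ 𝔄.anti P
  | .neg A, b, s => 𝔄.Sat A (!b) s
  | .and A B, true, s => 𝔄.Sat A true s ∧ 𝔄.Sat B true s
  | .and A B, false, s => 𝔄.Sat A false s ∨ 𝔄.Sat B false s
  | .or A B, true, s => 𝔄.Sat A true s ∨ 𝔄.Sat B true s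
  | .or A B, false, s => 𝔄.Sat A false s ∧ 𝔄.Sat B false s
  | .all x A, true, s => ∀ a, 𝔄.Sat A true (Function.update s x a)
  | .all x A, false, s => ∃ a, 𝔄.Sat A false (Function.update s x a)
  | .ex x A, true, s => ∃ a, 𝔄.Sat A true (Function.update s x a)
  | .ex x A, false, s => ∀ a, 𝔄.Sat A false (Function.update s x a)

variable (𝔄 : Struct.{u, v, w} S)

theorem sat_subst (x : ℕ) (c : S.Const) (A : Form S) (b : Bool) (s : ℕ → 𝔄.Dom) :
    𝔄.Sat (A.subst x c) b s ↔ 𝔄.Sat A b (Function.update s x (𝔄.den c)) := by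
  induction A generalizing b s with
  | atom P t =>
    have key (i) : 𝔄.termVal s ((t i).subst x c) =
        𝔄.termVal (Function.update s x (𝔄.den c)) (t i) := by
      cases t i with
      | var y => by_cases h : y = x <;> simp [Term.subst, termVal, h]
      | const d => rfl
    cases b <;> simp only [Form.subst, Sat, key]
  | all y A ih =>
    by_cases h : y = x
    · subst h
      cases b <;> simp [Form.subst, Sat]
    · cases b <;> simp [Form.subst, Sat, h, ih, Function.update_comm h]
  | ex y A ih =>
    by_cases h : y = x
    · subst h
      cases b <;> simp [Form.subst, Sat]
    · cases b <;> simp [Form.subst, Sat, h, ih, Function.update_comm h]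
  | neg A ih => exact ih _ _
  | and A B ihA ihB => cases b <;> simp [Form.subst, Sat, ihA, ihB]
  | or A B ihA ihB => cases b <;> simp [Form.subst, Sat, ihA, ihB]

/-- The pullback of a structure along a renaming; along an inclusion of signatures it is the
reduct. -/
def comap (φ : Renaming S S') (𝔄 : Struct.{u', v', w} S') : Struct.{u, v, w} S where
  Dom := 𝔄.Dom
  nonempty := 𝔄.nonempty
  den c := 𝔄.den (φ.const c)
  ext P := 𝔄.ext (φ.pred P)
  anti P := 𝔄.anti (φ.pred P)
  ext_eq := by rw [φ.pred_eq, 𝔄.ext_eq]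

theorem sat_map (φ : Renaming S S') (𝔄 : Struct.{u', v', w} S') (A : Form S) (b : Bool)
    (s : ℕ → 𝔄.Dom) : 𝔄.Sat (A.map φ) b s ↔ (𝔄.comap φ).Sat A b s := by
  induction A generalizing b s with
  | atom P t =>
    have key (i) : 𝔄.termVal s ((t i).map φ) = (𝔄.comap φ).termVal s (t i) := by
      cases t i <;> rfl
    cases b <;> simp only [Form.map, Sat, key] <;> rfl
  | neg A ih => exact ih _ _
  | and A B ihA ihB => cases b <;> simp [Form.map, Sat, ihA, ihB]
  | or A B ihA ihB => cases b <;> simp [Form.map, Sat, ihA, ihB]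
  | all x A ih => cases b <;> simp [Form.map, Sat, ih] <;> rfl
  | ex x A ih => cases b <;> simp [Form.map, Sat, ih] <;> rfl

open Classical in
/-- The structure that differs from `𝔄` at most in that `c` denotes `a`. -/
noncomputable def setDen (c : S.Const) (a : 𝔄.Dom) : Struct.{u, v, w} S :=
  { 𝔄 with den := Function.update 𝔄.den c a }

theorem sat_setDen {c : S.Const} (a : 𝔄.Dom) {A : Form S} (h : ¬ A.Occurs c) (b : Bool)
    (s : ℕ → 𝔄.Dom) : (𝔄.setDen c a).Sat A b s ↔ 𝔄.Sat A b s := by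
  induction A generalizing b s with
  | atom P t =>
    have key (i) : (𝔄.setDen c a).termVal s (t i) = 𝔄.termVal s (t i) := by
      cases hi : t i with
      | var y => rfl
      | const e =>
        have : e ≠ c := fun he => h ⟨i, he ▸ hi⟩
        simp [setDen, termVal, this]
    cases b <;> simp only [Sat, key] <;> rfl
  | neg A ih => exact ih h _ _
  | and A B ihA ihB =>
    rw [Form.Occurs, not_or] at h
    cases b <;> simp [Sat, ihA h.1, ihB h.2]
  | or A B ihA ihB =>
    rw [Form.Occurs, not_or] at h
    cases b <;> simp [Sat, ihA h.1, ihB h.2]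
  | all x A ih => cases b <;> simp only [Sat, ← ih h] <;> rfl
  | ex x A ih => cases b <;> simp only [Sat, ← ih h] <;> rfl

theorem sat_inst_setDen {x : ℕ} {A : Form1 S x} {c : S.Const} (h : ¬ A.1.Occurs c) (a : 𝔄.Dom)
    (b : Bool) (s : ℕ → 𝔄.Dom) :
    (𝔄.setDen c a).Sat (Sent.inst A c).1 b s ↔ 𝔄.Sat A.1 b (Function.update s x a) := by
  rw [← 𝔄.sat_setDen a h]
  refine ((𝔄.setDen c a).sat_subst x c A.1 b s).trans ?_
  simp [setDen]

open Classical in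
theorem isInducedValuation_sat (s : ℕ → 𝔄.Dom) :
    𝔄.IsInducedValuation fun A => decide (𝔄.hat.Sat A.1 true s) := by
  have inst {x : ℕ} (A : Form1 𝔄.diagram x) (a : 𝔄.Dom) (b : Bool) :
      𝔄.hat.Sat (Sent.inst A (𝔄.name a)).1 b s ↔ 𝔄.hat.Sat A.1 b (Function.update s x a) :=
    𝔄.hat.sat_subst x (𝔄.name a) A.1 b s
  constructor <;> intros <;> rw [decide_eq_true_iff]
  case atom => rfl
  case neg_atom => rfl
  case and | or | neg_and | neg_or => simp only [decide_eq_true_iff]; rfl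
  case neg_neg => rw [decide_eq_true_iff]; rfl
  case all => simp only [decide_eq_true_iff, inst]; rfl
  case ex => simp only [decide_eq_true_iff, inst]; rfl
  case neg_all =>
    simp only [decide_eq_true_iff]
    exact exists_congr fun a => (inst _ a false).symm
  case neg_ex =>
    simp only [decide_eq_true_iff]
    exact forall_congr' fun a => (inst _ a false).symm

theorem IsInducedValuation.unique {𝔄 : Struct.{u, v, w} S} {f g : Sent 𝔄.diagram → Bool}
    (hf : 𝔄.IsInducedValuation f) (hg : 𝔄.IsInducedValuation g) : f = g := by
  -- The clauses for negated compounds call for a simultaneous induction on `A` and `¬A`.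
  suffices H : ∀ A, (f A = true ↔ g A = true) ∧ (f A.neg = true ↔ g A.neg = true) from
    funext fun A => Bool.eq_iff_iff.2 (H A).1
  intro A
  induction A using Sent.induction with
  | atom P c => rw [hf.atom, hg.atom, hf.neg_atom, hg.neg_atom]; simp
  | neg A ih => rw [hf.neg_neg, hg.neg_neg]; exact ih.symm
  | and A B ihA ihB =>
    rw [hf.and, hg.and, hf.neg_and, hg.neg_and, ihA.1, ihA.2, ihB.1, ihB.2]; simp
  | or A B ihA ihB =>
    rw [hf.or, hg.or, hf.neg_or, hg.neg_or, ihA.1, ihA.2, ihB.1, ihB.2]; simp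
  | all A hx ih =>
    rw [hf.all, hg.all, hf.neg_all, hg.neg_all]
    exact ⟨forall_congr' fun a => (ih _).1, exists_congr fun a => (ih _).2⟩
  | ex A hx ih =>
    rw [hf.ex, hg.ex, hf.neg_ex, hg.neg_ex]
    exact ⟨exists_congr fun a => (ih _).1, forall_congr' fun a => (ih _).2⟩

open Classical in
theorem holds_iff_sat (s : ℕ → 𝔄.Dom) (A : Sent S) : 𝔄.Holds A ↔ 𝔄.Sat A.1 true s := by
  have key : 𝔄.hat.Sat (A.lift 𝔄.Dom).1 true s ↔ 𝔄.Sat A.1 true s := by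
    change 𝔄.hat.Sat (A.1.lift 𝔄.Dom) true s ↔ _
    rw [Form.lift_eq_map]
    exact sat_map (Renaming.inclusion S 𝔄.Dom) 𝔄.hat A.1 true s
  rw [← key]
  constructor
  · rintro ⟨f, hf, h⟩
    rw [hf.unique (𝔄.isInducedValuation_sat s)] at h
    exact of_decide_eq_true h
  · exact fun h => ⟨_, 𝔄.isInducedValuation_sat s, decide_eq_true h⟩

theorem existsUnique_isInducedValuation :
    ∃! val : Sent 𝔄.diagram → Bool, 𝔄.IsInducedValuation val := by
  obtain ⟨a⟩ := 𝔄.nonempty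
  exact ⟨_, 𝔄.isInducedValuation_sat fun _ => a, fun _ h => h.unique (𝔄.isInducedValuation_sat _)⟩

end Struct

/-! ### Soundness -/

/-- Soundness for satisfaction. An eigenconstant is handled by changing its denotation, which
affects neither the other hypotheses nor the conclusion. -/
theorem Deriv.sound {Γ : Set (Sent S)} {A : Sent S} (h : Deriv Γ A) (𝔄 : Struct.{u, v, w} S)
    (s : ℕ → 𝔄.Dom) (hΓ : ∀ B ∈ Γ, 𝔄.Sat B.1 true s) : 𝔄.Sat A.1 true s := by
  have hinst {x : ℕ} (A : Form1 S x) (c : S.Const) (b : Bool) (𝔄 : Struct.{u, v, w} S)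
      (s : ℕ → 𝔄.Dom) :
      𝔄.Sat (Sent.inst A c).1 b s ↔ 𝔄.Sat A.1 b (Function.update s x (𝔄.den c)) :=
    𝔄.sat_subst x c A.1 b s
  -- Truth of the hypotheses of a minor premise, with the discharged hypothesis added.
  have hins {Δ : Set (Sent S)} {B : Sent S} {𝔄 : Struct.{u, v, w} S} {s : ℕ → 𝔄.Dom}
      (h₁ : ∀ H ∈ Δ \ {B}, 𝔄.Sat H.1 true s) (h₂ : 𝔄.Sat B.1 true s) :
      ∀ H ∈ Δ, 𝔄.Sat H.1 true s := fun H hH => by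
    by_cases h : H = B
    · exact h ▸ h₂
    · exact h₁ H ⟨hH, h⟩
  induction h generalizing 𝔄 with
  | hyp A => exact hΓ A rfl
  | andI _ _ ih₁ ih₂ =>
    exact ⟨ih₁ 𝔄 s fun B hB => hΓ B (.inl hB), ih₂ 𝔄 s fun B hB => hΓ B (.inr hB)⟩
  | andE₁ _ ih => exact (ih 𝔄 s hΓ).1
  | andE₂ _ ih => exact (ih 𝔄 s hΓ).2
  | orI₁ _ ih => exact .inl (ih 𝔄 s hΓ)
  | orI₂ _ ih => exact .inr (ih 𝔄 s hΓ)
  | orE _ _ _ ih ih₁ ih₂ | negAndE _ _ _ ih ih₁ ih₂ =>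
    rcases ih 𝔄 s fun B hB => hΓ B (.inl (.inl hB)) with h | h
    · exact ih₁ 𝔄 s (hins (fun B hB => hΓ B (.inl (.inr hB))) h)
    · exact ih₂ 𝔄 s (hins (fun B hB => hΓ B (.inr hB)) h)
  | negAndI₁ _ ih => exact .inl (ih 𝔄 s hΓ)
  | negAndI₂ _ ih => exact .inr (ih 𝔄 s hΓ)
  | negOrI _ _ ih₁ ih₂ =>
    exact ⟨ih₁ 𝔄 s fun B hB => hΓ B (.inl hB), ih₂ 𝔄 s fun B hB => hΓ B (.inr hB)⟩
  | negOrE₁ _ ih => exact (ih 𝔄 s hΓ).1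
  | negOrE₂ _ ih => exact (ih 𝔄 s hΓ).2
  | dnI _ ih => exact ih 𝔄 s hΓ
  | dnE _ ih => exact ih 𝔄 s hΓ
  | @allI Γ B x A hx c _ hA hB hΓc ih =>
    by_cases h : 𝔄.Sat B.1 true s
    · exact .inl h
    · refine .inr fun a => ?_
      have := ih (𝔄.setDen c a) s fun H hH => (𝔄.sat_setDen a (hΓc H hH) true s).2 (hΓ H hH)
      rcases this with h' | h'
      · exact absurd ((𝔄.sat_setDen a hB true s).1 h') h
      · exact (𝔄.sat_inst_setDen hA a true s).1 h'
  | allE hx c _ ih => exact (hinst _ c true 𝔄 s).2 (ih 𝔄 s hΓ (𝔄.den c))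
  | exI hx c _ ih => exact ⟨𝔄.den c, (hinst _ c true 𝔄 s).1 (ih 𝔄 s hΓ)⟩
  | @exE Γ Δ C x A hx c _ _ hA hC hΔ ih₁ ih₂ =>
    obtain ⟨a, ha⟩ := ih₁ 𝔄 s fun H hH => hΓ H (.inl hH)
    refine (𝔄.sat_setDen a hC true s).1 (ih₂ (𝔄.setDen c a) s (hins (fun H hH => ?_)
      ((𝔄.sat_inst_setDen hA a true s).2 ha)))
    exact (𝔄.sat_setDen a (hΔ H hH) true s).2 (hΓ H (.inr hH))
  | negAllI hx c _ ih => exact ⟨𝔄.den c, (hinst _ c false 𝔄 s).1 (ih 𝔄 s hΓ)⟩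
  | @negAllE Γ Δ C x A hx c _ _ hA hC hΔ ih₁ ih₂ =>
    obtain ⟨a, ha⟩ := ih₁ 𝔄 s fun H hH => hΓ H (.inl hH)
    refine (𝔄.sat_setDen a hC true s).1 (ih₂ (𝔄.setDen c a) s (hins
      (B := (Sent.inst A c).neg) (fun H hH => ?_)
      ((𝔄.sat_inst_setDen hA a false s).2 ha)))
    exact (𝔄.sat_setDen a (hΔ H hH) true s).2 (hΓ H (.inr hH))
  | @negExI Γ x A hx c _ hA hΓc ih =>
    intro a
    exact (𝔄.sat_inst_setDen hA a false s).1
      (ih (𝔄.setDen c a) s fun H hH => (𝔄.sat_setDen a (hΓc H hH) true s).2 (hΓ H hH))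
  | negExE hx c _ ih => exact (hinst _ c false 𝔄 s).2 (ih 𝔄 s hΓ (𝔄.den c))
  | eqI c =>
    change _ ∈ 𝔄.ext S.eq
    rw [𝔄.ext_eq]
    rfl
  | @eqE Γ Δ x A c₁ c₂ _ _ ih₁ ih₂ =>
    have h : _ ∈ 𝔄.ext S.eq := ih₁ 𝔄 s fun H hH => hΓ H (.inl hH)
    rw [𝔄.ext_eq] at h
    have h : 𝔄.den c₁ = 𝔄.den c₂ := h
    rw [hinst, ← h, ← hinst]
    exact ih₂ 𝔄 s fun H hH => hΓ H (.inr hH)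

theorem Provable.sound {Γ : Set (Sent S)} {A : Sent S} (h : Provable Γ A) :
    Entails.{u, v, w} Γ A := by
  intro 𝔄 hΓ
  obtain ⟨a⟩ := 𝔄.nonempty
  obtain ⟨Γ₀, h₀, d⟩ := h
  rw [𝔄.holds_iff_sat fun _ => a]
  exact d.sound 𝔄 _ fun B hB => (𝔄.holds_iff_sat _ B).1 (hΓ B (h₀ hB))

/-! ### The canonical model of a saturated theory -/

/-- A prime theory such that every existential sentence in it has an instance in it and every
universal sentence outside it has an instance outside it, negated universal sentences being
treated as existential and negated existential ones as universal. -/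
structure Saturated (T : Set (Sent S)) : Prop where
  closed : ∀ {A}, Provable T A → A ∈ T
  or : ∀ {A B : Sent S}, A.or B ∈ T → A ∈ T ∨ B ∈ T
  ex : ∀ {x : ℕ} {E : Form1 S x} (hx : x ∈ E.1.FV), Sent.ex E hx ∈ T → ∃ c, Sent.inst E c ∈ T
  neg_all : ∀ {x : ℕ} {E : Form1 S x} (hx : x ∈ E.1.FV),
    (Sent.all E hx).neg ∈ T → ∃ c, (Sent.inst E c).neg ∈ T
  all : ∀ {x : ℕ} {E : Form1 S x} (hx : x ∈ E.1.FV),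
    (∀ c, Sent.inst E c ∈ T) → Sent.all E hx ∈ T
  neg_ex : ∀ {x : ℕ} {E : Form1 S x} (hx : x ∈ E.1.FV),
    (∀ c, (Sent.inst E c).neg ∈ T) → (Sent.ex E hx).neg ∈ T

/-- The literal `P(c₁, …, cₙ)` for `true`, and `¬P(c₁, …, cₙ)` for `false`. -/
def Sent.literal {n : ℕ} (b : Bool) (P : S.Pred n) (c : Fin n → S.Const) : Sent S :=
  bif b then Sent.atom P c else (Sent.atom P c).neg

/-- The literal in which the `i`-th argument is replaced by the variable `v₀`. -/
def Form1.literal {n : ℕ} (b : Bool) (P : S.Pred n) (c : Fin n → S.Const) (i : Fin n) :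
    Form1 S 0 :=
  have h : (Form.atom P (Function.update (fun j => Term.const (c j)) i (Term.var 0))).FV ⊆ {0} := by
    rintro x ⟨j, hj⟩
    by_cases hji : j = i
    · subst hji
      simpa [eq_comm] using hj
    · simp [hji] at hj
  match b with
  | true => ⟨.atom P (Function.update (fun j => .const (c j)) i (.var 0)), trivial, h⟩
  | false => ⟨.neg (.atom P (Function.update (fun j => .const (c j)) i (.var 0))), trivial, h⟩

theorem Form1.inst_literal {n : ℕ} (b : Bool) (P : S.Pred n) (c : Fin n → S.Const) (i : Fin n)
    (d : S.Const) :
    Sent.inst (Form1.literal b P c i) d = Sent.literal b P (Function.update c i d) := by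
  have (j : Fin n) : (Function.update (fun j => Term.const (c j)) i (Term.var 0) j).subst 0 d =
      Term.const (Function.update c i d j) := by
    by_cases hji : j = i
    · subst hji
      simp [Term.subst]
    · simp [hji, Term.subst]
  cases b <;> refine Subtype.ext ?_ <;>
    simp only [Sent.inst, Form1.literal, Sent.literal, Form.subst, this, cond_true, cond_false] <;>
    rfl

namespace Saturated

variable {T : Set (Sent S)}

theorem literal_update (hT : Saturated T) {n : ℕ} {b : Bool} {P : S.Pred n}
    {c : Fin n → S.Const} {i : Fin n} {d : S.Const} (h : Sent.literal b P c ∈ T)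
    (hd : Sent.eq (c i) d ∈ T) :
    Sent.literal b P (Function.update c i d) ∈ T := by
  rw [← Form1.inst_literal]
  refine hT.closed (.eqE (.of_mem hd) (.of_mem ?_))
  rwa [Form1.inst_literal, Function.update_eq_self]

theorem literal_congr (hT : Saturated T) {n : ℕ} {b : Bool} {P : S.Pred n}
    {c d : Fin n → S.Const} (h : Sent.literal b P c ∈ T) (hd : ∀ i, Sent.eq (c i) (d i) ∈ T) :
    Sent.literal b P d ∈ T := by
  classical
  have key (s : Finset (Fin n)) : Sent.literal b P (s.piecewise d c) ∈ T := by
    induction s using Finset.induction_on with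
    | empty => simpa using h
    | insert i s hi ih =>
      rw [Finset.piecewise_insert]
      refine hT.literal_update ih ?_
      rw [Finset.piecewise_eq_of_notMem _ _ _ hi]
      exact hd i
  simpa using key Finset.univ

theorem eq_refl (hT : Saturated T) (c : S.Const) : Sent.eq c c ∈ T := hT.closed (.eqI c)

theorem eq_symm (hT : Saturated T) {c d : S.Const} (h : Sent.eq c d ∈ T) : Sent.eq d c ∈ T := by
  have := hT.literal_update (b := true) (P := S.eq) (c := ![c, c]) (i := 0) (d := d)
    (hT.eq_refl c) h
  rwa [show Function.update ![c, c] 0 d = ![d, c] by ext i; fin_cases i <;> rfl] at this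

theorem eq_trans (hT : Saturated T) {c d e : S.Const} (h : Sent.eq c d ∈ T) (h' : Sent.eq d e ∈ T) :
    Sent.eq c e ∈ T := by
  have := hT.literal_update (b := true) (P := S.eq) (c := ![c, d]) (i := 1) (d := e) h h'
  rwa [show Function.update ![c, d] 1 e = ![c, e] by ext i; fin_cases i <;> rfl] at this

/-- Identity of constants according to `T`. -/
def setoid (hT : Saturated T) : Setoid S.Const where
  r c d := Sent.eq c d ∈ T
  iseqv := ⟨hT.eq_refl, hT.eq_symm, hT.eq_trans⟩

/-- The set of tuples of denotations of the arguments of the literals with a given sign and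
predicate letter that belong to `T`. -/
def rel (hT : Saturated T) (b : Bool) {n : ℕ} (P : S.Pred n) : Set (Fin n → Quotient hT.setoid) :=
  {p | ∃ c, (fun i => Quotient.mk hT.setoid (c i)) = p ∧ Sent.literal b P c ∈ T}

theorem mem_rel (hT : Saturated T) {b : Bool} {n : ℕ} {P : S.Pred n} {c : Fin n → S.Const} :
    (fun i => Quotient.mk hT.setoid (c i)) ∈ hT.rel b P ↔ Sent.literal b P c ∈ T :=
  ⟨fun ⟨_, h, h'⟩ => hT.literal_congr h' fun i => Quotient.exact (congrFun h i),
    fun h => ⟨c, rfl, h⟩⟩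

/-- The model whose elements are the constants, up to provable identity. -/
def model (hT : Saturated T) : Struct S where
  Dom := Quotient hT.setoid
  nonempty := (@Infinite.nonempty _ S.infinite).map (Quotient.mk _)
  den := Quotient.mk _
  ext := hT.rel true
  anti := hT.rel false
  ext_eq := by
    ext p
    obtain ⟨c, rfl⟩ : ∃ c : Fin 2 → S.Const, (fun i => Quotient.mk hT.setoid (c i)) = p :=
      ⟨fun i => (p i).out, funext fun i => Quotient.out_eq _⟩
    rw [hT.mem_rel, show c = ![c 0, c 1] by ext i; fin_cases i <;> rfl]
    exact (Quotient.eq (r := hT.setoid)).symm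

/-- The truth lemma. -/
theorem sat_model_iff (hT : Saturated T) (s : ℕ → hT.model.Dom) (A : Sent S) :
    (hT.model.Sat A.1 true s ↔ A ∈ T) ∧ (hT.model.Sat A.1 false s ↔ A.neg ∈ T) := by
  have rule {A B : Sent S} (f : ∀ {Γ}, Deriv Γ A → Deriv Γ B) (h : A ∈ T) : B ∈ T :=
    hT.closed ((Provable.of_mem h).lift₁ f)
  have sat_inst {x : ℕ} (E : Form1 S x) (b : Bool) (c : S.Const) :
      hT.model.Sat E.1 b (Function.update s x (Quotient.mk _ c)) ↔
        hT.model.Sat (Sent.inst E c).1 b s :=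
    (hT.model.sat_subst x c E.1 b s).symm
  have sat_all {x : ℕ} (E : Form1 S x) (b : Bool) :
      (∀ a, hT.model.Sat E.1 b (Function.update s x a)) ↔
        ∀ c, hT.model.Sat (Sent.inst E c).1 b s :=
    Quotient.forall.trans (forall_congr' fun c => sat_inst E b c)
  have sat_ex {x : ℕ} (E : Form1 S x) (b : Bool) :
      (∃ a, hT.model.Sat E.1 b (Function.update s x a)) ↔
        ∃ c, hT.model.Sat (Sent.inst E c).1 b s :=
    Quotient.exists.trans (exists_congr fun c => sat_inst E b c)
  induction A using Sent.induction with
  | atom P c => exact ⟨hT.mem_rel (b := true), hT.mem_rel (b := false)⟩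
  | neg A ih => exact ⟨ih.2, ih.1.trans ⟨rule .dnI, rule .dnE⟩⟩
  | and A B ihA ihB =>
    refine ⟨(and_congr ihA.1 ihB.1).trans ⟨fun h => ?_, fun h => ⟨rule .andE₁ h, rule .andE₂ h⟩⟩,
      (or_congr ihA.2 ihB.2).trans ⟨?_, fun h => ?_⟩⟩
    · exact hT.closed (.andI (.of_mem h.1) (.of_mem h.2))
    · rintro (h | h)
      · exact rule .negAndI₁ h
      · exact rule .negAndI₂ h
    · exact hT.or (hT.closed (.negAndE (.of_mem h)
        (Provable.lift₁ .orI₁ (.of_mem (Set.mem_insert _ _)))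
        (Provable.lift₁ .orI₂ (.of_mem (Set.mem_insert _ _)))))
  | or A B ihA ihB =>
    refine ⟨(or_congr ihA.1 ihB.1).trans ⟨?_, hT.or⟩,
      (and_congr ihA.2 ihB.2).trans ⟨fun h => ?_, fun h => ⟨rule .negOrE₁ h, rule .negOrE₂ h⟩⟩⟩
    · rintro (h | h)
      · exact rule .orI₁ h
      · exact rule .orI₂ h
    · exact hT.closed (.negOrI (.of_mem h.1) (.of_mem h.2))
  | all E hx ih =>
    exact ⟨(sat_all E true).trans ((forall_congr' fun c => (ih c).1).trans
        ⟨hT.all hx, fun h c => rule (.allE hx c) h⟩),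
      (sat_ex E false).trans ((exists_congr fun c => (ih c).2).trans
        ⟨fun ⟨c, h⟩ => rule (.negAllI hx c) h, hT.neg_all hx⟩)⟩
  | ex E hx ih =>
    exact ⟨(sat_ex E true).trans ((exists_congr fun c => (ih c).1).trans
        ⟨fun ⟨c, h⟩ => rule (.exI hx c) h, hT.ex hx⟩),
      (sat_all E false).trans ((forall_congr' fun c => (ih c).2).trans
        ⟨hT.neg_ex hx, fun h c => rule (.negExE hx c) h⟩)⟩

end Saturated

/-! ### Consistent pairs -/

/-- The closure of a set of sentences under disjunction. -/
inductive OrClosure (F : Set (Sent S)) : Sent S → Prop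
  | of_mem {A : Sent S} : A ∈ F → OrClosure F A
  | or {A B : Sent S} : OrClosure F A → OrClosure F B → OrClosure F (A.or B)

/-- No disjunction of sentences in `F` is derivable from `T`. -/
def Consistent (T F : Set (Sent S)) : Prop := ∀ D, OrClosure F D → ¬ Provable T D

section Consistent

variable {T T' F F' : Set (Sent S)} {A C D : Sent S} {c : S.Const}

theorem OrClosure.mono (h : F ⊆ F') (hD : OrClosure F D) : OrClosure F' D := by
  induction hD with
  | of_mem hA => exact .of_mem (h hA)
  | or _ _ ih₁ ih₂ => exact ih₁.or ih₂

theorem OrClosure.exists_finite (hD : OrClosure F D) :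
    ∃ F₀ ⊆ F, F₀.Finite ∧ OrClosure F₀ D := by
  induction hD with
  | @of_mem A hA =>
    exact ⟨{A}, Set.singleton_subset_iff.2 hA, Set.finite_singleton A, .of_mem rfl⟩
  | or _ _ ih₁ ih₂ =>
    obtain ⟨F₁, h₁, hf₁, hc₁⟩ := ih₁
    obtain ⟨F₂, h₂, hf₂, hc₂⟩ := ih₂
    exact ⟨F₁ ∪ F₂, Set.union_subset h₁ h₂, hf₁.union hf₂,
      (hc₁.mono Set.subset_union_left).or (hc₂.mono Set.subset_union_right)⟩

theorem OrClosure.not_occurs (hF : ∀ B ∈ F, ¬ B.Occurs c) (hD : OrClosure F D) :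
    ¬ D.Occurs c := by
  induction hD with
  | of_mem hA => exact hF _ hA
  | or _ _ ih₁ ih₂ => exact not_or.2 ⟨ih₁, ih₂⟩

theorem OrClosure.exists_or_of_insert (hF : F.Nonempty) (hD : OrClosure (insert A F) D) :
    ∃ D', OrClosure F D' ∧ Provable {D} (D'.or A) := by
  induction hD with
  | @of_mem B hB =>
    rcases hB with rfl | hB
    · obtain ⟨D', hD'⟩ := hF
      exact ⟨D', .of_mem hD', Provable.lift₁ .orI₂ (.of_mem rfl)⟩
    · exact ⟨B, .of_mem hB, Provable.lift₁ .orI₁ (.of_mem rfl)⟩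
  | @or B₁ B₂ _ _ ih₁ ih₂ =>
    obtain ⟨D₁, h₁, p₁⟩ := ih₁
    obtain ⟨D₂, h₂, p₂⟩ := ih₂
    refine ⟨D₁.or D₂, h₁.or h₂, .orE (.of_mem rfl) (.orE (p₁.mono (by simp)) ?_ ?_)
      (.orE (p₂.mono (by simp)) ?_ ?_)⟩
    · exact .lift₁ .orI₁ (.lift₁ .orI₁ (.of_mem (Set.mem_insert _ _)))
    · exact .lift₁ .orI₂ (.of_mem (Set.mem_insert _ _))
    · exact .lift₁ .orI₁ (.lift₁ .orI₂ (.of_mem (Set.mem_insert _ _)))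
    · exact .lift₁ .orI₂ (.of_mem (Set.mem_insert _ _))

theorem Consistent.anti (h : Consistent T' F') (hT : T ⊆ T') (hF : F ⊆ F') : Consistent T F :=
  fun D hD p => h D (hD.mono hF) (p.mono hT)

/-- Every sentence can be consistently accepted or consistently rejected. -/
theorem Consistent.insert_or (h : Consistent T F) (hF : F.Nonempty) (A : Sent S)
    (hA : ¬ Consistent (insert A T) F) : Consistent T (insert A F) := by
  intro D hD p
  apply hA
  intro D₁ hD₁ p₁
  obtain ⟨D', hD', p'⟩ := hD.exists_or_of_insert hF
  refine h (D'.or D₁) (hD'.or hD₁) ((p.trans p').orE ?_ ?_)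
  · exact .lift₁ .orI₁ (.of_mem (Set.mem_insert _ _))
  · exact .lift₁ .orI₂ p₁

/-- `C` is the `c`-instance of the existential, or negated universal, sentence `A`. -/
def TrueWitness (A : Sent S) (c : S.Const) (C : Sent S) : Prop :=
  ∃ (x : ℕ) (E : Form1 S x) (hx : x ∈ E.1.FV),
    A = Sent.ex E hx ∧ C = Sent.inst E c ∨ A = (Sent.all E hx).neg ∧ C = (Sent.inst E c).neg

/-- `C` is the `c`-instance of the universal, or negated existential, sentence `A`. -/
def FalseWitness (A : Sent S) (c : S.Const) (C : Sent S) : Prop :=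
  ∃ (x : ℕ) (E : Form1 S x) (hx : x ∈ E.1.FV),
    A = Sent.all E hx ∧ C = Sent.inst E c ∨ A = (Sent.ex E hx).neg ∧ C = (Sent.inst E c).neg

theorem TrueWitness.unique {C' : Sent S} (h : TrueWitness A c C) (h' : TrueWitness A c C') :
    C = C' := by
  obtain ⟨x, E, hx, ⟨rfl, rfl⟩ | ⟨rfl, rfl⟩⟩ := h <;>
    obtain ⟨y, E', hy, ⟨hA, rfl⟩ | ⟨hA, rfl⟩⟩ := h' <;>
    have hA := congrArg Subtype.val hA <;>
    simp only [Sent.ex, Sent.all, Sent.neg, Form.ex.injEq, Form.neg.injEq, Form.all.injEq,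
      reduceCtorEq] at hA <;>
    exact Subtype.ext (by simp [Sent.inst, Sent.neg, hA.1, hA.2])

theorem FalseWitness.unique {C' : Sent S} (h : FalseWitness A c C) (h' : FalseWitness A c C') :
    C = C' := by
  obtain ⟨x, E, hx, ⟨rfl, rfl⟩ | ⟨rfl, rfl⟩⟩ := h <;>
    obtain ⟨y, E', hy, ⟨hA, rfl⟩ | ⟨hA, rfl⟩⟩ := h' <;>
    have hA := congrArg Subtype.val hA <;>
    simp only [Sent.ex, Sent.all, Sent.neg, Form.ex.injEq, Form.neg.injEq, Form.all.injEq,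
      reduceCtorEq] at hA <;>
    exact Subtype.ext (by simp [Sent.inst, Sent.neg, hA.1, hA.2])

theorem TrueWitness.occurs {d : S.Const} (h : TrueWitness A c C) (hC : C.Occurs d) :
    A.Occurs d ∨ d = c := by
  obtain ⟨x, E, hx, ⟨rfl, rfl⟩ | ⟨rfl, rfl⟩⟩ := h <;>
    exact Form.occurs_of_occurs_subst (A := E.1) hC

theorem FalseWitness.occurs {d : S.Const} (h : FalseWitness A c C) (hC : C.Occurs d) :
    A.Occurs d ∨ d = c := by
  obtain ⟨x, E, hx, ⟨rfl, rfl⟩ | ⟨rfl, rfl⟩⟩ := h <;>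
    exact Form.occurs_of_occurs_subst (A := E.1) hC

theorem Consistent.insert_trueWitness (h : Consistent (insert A T) F) (hC : TrueWitness A c C)
    (hA : ¬ A.Occurs c) (hT : ∀ B ∈ T, ¬ B.Occurs c) (hF : ∀ B ∈ F, ¬ B.Occurs c) :
    Consistent (insert C (insert A T)) F := by
  intro D hD p
  refine h D hD ?_
  have hAT : ∀ B ∈ insert A T, ¬ B.Occurs c := Set.forall_mem_insert.2 ⟨hA, hT⟩
  obtain ⟨x, E, hx, ⟨rfl, rfl⟩ | ⟨rfl, rfl⟩⟩ := hC
  · exact .exE hx hA (hD.not_occurs hF) hAT (.of_mem (Set.mem_insert _ _)) p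
  · exact .negAllE hx hA (hD.not_occurs hF) hAT (.of_mem (Set.mem_insert _ _)) p

/-- The rule for introducing a universal sentence in a disjunction, and its derivable counterpart
for a negated existential sentence: `∀x ¬E` entails `¬∃x E`. -/
theorem Provable.or_of_falseWitness (h : Provable T (D.or C)) (hC : FalseWitness A c C)
    (hA : ¬ A.Occurs c) (hD : ¬ D.Occurs c) (hT : ∀ B ∈ T, ¬ B.Occurs c) :
    Provable T (D.or A) := by
  obtain ⟨x, E, hx, ⟨rfl, rfl⟩ | ⟨rfl, rfl⟩⟩ := hC
  · exact h.allI hx hA hD hT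
  · have h' : Provable T (D.or (Sent.all (⟨.neg E.1, E.2⟩ : Form1 S x) hx)) :=
      h.allI (E := ⟨.neg E.1, E.2⟩) hx hA hD hT
    refine h'.orE (.lift₁ .orI₁ (.of_mem (Set.mem_insert _ _))) (.lift₁ .orI₂ ?_)
    refine .negExI (c := c) hx hA (Set.forall_mem_insert.2 ⟨hA, hT⟩) ?_
    exact Provable.lift₁ (.allE (A := (⟨.neg E.1, E.2⟩ : Form1 S x)) hx c)
      (.of_mem (Set.mem_insert _ _))

theorem Consistent.insert_falseWitness (h : Consistent T (insert A F)) (hC : FalseWitness A c C)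
    (hA : ¬ A.Occurs c) (hT : ∀ B ∈ T, ¬ B.Occurs c) (hF : ∀ B ∈ F, ¬ B.Occurs c) :
    Consistent T (insert C (insert A F)) := by
  intro D hD p
  obtain ⟨D', hD', p'⟩ := hD.exists_or_of_insert (Set.insert_nonempty A F)
  exact h (D'.or A) (hD'.or (.of_mem (Set.mem_insert _ _)))
    ((p.trans p').or_of_falseWitness hC hA
      (hD'.not_occurs (Set.forall_mem_insert.2 ⟨hA, hF⟩)) hT)

end Consistent

/-! ### Saturation by transfinite recursion -/

/-- A set can be defined by deciding, by well-founded recursion, whether each element belongs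
to it. -/
theorem exists_set_wellFounded_rec {α : Type*} [Preorder α] [WellFoundedLT α]
    (p : α → Set α → Prop) : ∃ X : Set α, ∀ a, a ∈ X ↔ p a (X ∩ Set.Iio a) := by
  let q : α → Prop := (wellFounded_lt (α := α)).fix fun a r => p a {b | ∃ h : b < a, r b h}
  refine ⟨{a | q a}, fun a => ?_⟩
  change q a ↔ _
  have : q a = p a {b | ∃ _ : b < a, q b} := WellFounded.fix_eq _ _ _
  rw [this]
  have : {b | ∃ _ : b < a, q b} = {a | q a} ∩ Set.Iio a := by
    ext b
    simp [and_comm]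
  rw [this]

/-- The sentences in `Γ` and in `X`, together with the witnesses for those in `X`, where the
witnessing constant for `B` is `f B`. -/
def augment (W : Sent S → S.Const → Sent S → Prop) (f : Sent S → S.Const) (Γ X : Set (Sent S)) :
    Set (Sent S) :=
  Γ ∪ {C | ∃ B ∈ X, C = B ∨ W B (f B) C}

section Saturation

variable {W : Sent S → S.Const → Sent S → Prop} {f : Sent S → S.Const} {Γ X Y : Set (Sent S)}

theorem augment_mono (h : X ⊆ Y) : augment W f Γ X ⊆ augment W f Γ Y :=
  Set.union_subset_union_right _ fun _ ⟨B, hB, hC⟩ => ⟨B, h hB, hC⟩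

theorem mem_augment {A : Sent S} (h : A ∈ X) : A ∈ augment W f Γ X := .inr ⟨A, h, .inl rfl⟩

theorem mem_augment_of_witness {A C : Sent S} (h : A ∈ X) (hC : W A (f A) C) :
    C ∈ augment W f Γ X := .inr ⟨A, h, .inr hC⟩

theorem exists_finite_subset_augment {Δ : Set (Sent S)} (hΔ : Δ.Finite)
    (h : Δ ⊆ augment W f Γ X) : ∃ X₀ ⊆ X, X₀.Finite ∧ Δ ⊆ augment W f Γ X₀ := by
  induction Δ, hΔ using Set.Finite.induction_on with
  | empty => exact ⟨∅, Set.empty_subset _, Set.finite_empty, Set.empty_subset _⟩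
  | @insert A Δ _ _ ih =>
    rw [Set.insert_subset_iff] at h
    obtain ⟨X₀, h₀, hf, hs⟩ := ih h.2
    rcases h.1 with hA | ⟨B, hB, hA⟩
    · exact ⟨X₀, h₀, hf, Set.insert_subset (.inl hA) hs⟩
    · exact ⟨insert B X₀, Set.insert_subset hB h₀, hf.insert B, Set.insert_subset
        (.inr ⟨B, Set.mem_insert _ _, hA⟩) (hs.trans (augment_mono (Set.subset_insert _ _)))⟩

/-- Adding one sentence to `X` adds it and at most one witness. -/
theorem augment_insert_subset {A : Sent S} (hXY : X ⊆ insert A Y)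
    (hW : ∀ C C', W A (f A) C → W A (f A) C' → C = C') :
    augment W f Γ X ⊆ insert A (augment W f Γ Y) ∨
      ∃ C, W A (f A) C ∧ augment W f Γ X ⊆ insert C (insert A (augment W f Γ Y)) := by
  by_cases h : ∃ C, W A (f A) C
  · obtain ⟨C, hC⟩ := h
    refine .inr ⟨C, hC, ?_⟩
    rintro D (hD | ⟨B, hB, hD⟩)
    · exact .inr (.inr (.inl hD))
    · rcases hXY hB with rfl | hB
      · rcases hD with rfl | hD
        · exact .inr (.inl rfl)
        · exact .inl (hW _ _ hD hC)
      · exact .inr (.inr (.inr ⟨B, hB, hD⟩))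
  · refine .inl ?_
    rintro D (hD | ⟨B, hB, hD⟩)
    · exact .inr (.inl hD)
    · rcases hXY hB with rfl | hB
      · rcases hD with rfl | hD
        · exact .inl rfl
        · exact absurd ⟨D, hD⟩ h
      · exact .inr (.inr ⟨B, hB, hD⟩)

/-- If distinct sentences are assigned distinct witnessing constants, which occur neither in `Γ`,
nor in `A₀`, nor in the sentences up to the one they are assigned to, then a theory not proving
`A₀` extends to a saturated one: the sentences are accepted or rejected one after the other, and
each time the witness, if there is one, is accepted or rejected as well. -/
theorem exists_saturated [LinearOrder (Sent S)] [WellFoundedLT (Sent S)]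
    (hf : ∀ A B : Sent S, B ≤ A → ¬ B.Occurs (f A)) (hf' : ∀ A B : Sent S, B < A → f A ≠ f B)
    (hΓ : ∀ A, ∀ B ∈ Γ, ¬ B.Occurs (f A)) {A₀ : Sent S} (hA₀ : ∀ A, ¬ A₀.Occurs (f A))
    (h : ¬ Provable Γ A₀) : ∃ T, Saturated T ∧ Γ ⊆ T ∧ A₀ ∉ T := by
  let acc := augment TrueWitness f Γ
  let rej := augment FalseWitness f {A₀}
  obtain ⟨X, hX⟩ := exists_set_wellFounded_rec fun (A : Sent S) Y =>
    Consistent (insert A (acc Y)) (rej (Set.Iio A \ Y))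
  simp only [Set.sdiff_inter_self_eq_sdiff] at hX
  have base : Consistent Γ {A₀} := by
    have entails {D : Sent S} (hD : OrClosure {A₀} D) : Provable {D} A₀ := by
      induction hD with
      | of_mem hA => exact .of_mem hA.symm
      | or _ _ ih₁ ih₂ =>
        exact .orE (.of_mem rfl) (ih₁.mono (by simp)) (ih₂.mono (by simp))
    exact fun D hD p => h (p.trans (entails hD))
  -- By compactness, consistency of all the stages in `I` passes to the limit.
  have limit (I : Set (Sent S))
      (hI : ∀ A ∈ I, Consistent (acc (X ∩ Set.Iic A)) (rej (Set.Iic A \ X))) :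
      Consistent (acc (X ∩ I)) (rej (I \ X)) := by
    rintro D hD ⟨Γ₀, hΓ₀, d⟩
    obtain ⟨X₁, hX₁, hfin₁, h₁⟩ := exists_finite_subset_augment d.finite hΓ₀
    obtain ⟨F₀, hF₀, hfin₀, hD⟩ := hD.exists_finite
    obtain ⟨X₂, hX₂, hfin₂, h₂⟩ := exists_finite_subset_augment hfin₀ hF₀
    rcases (X₁ ∪ X₂).eq_empty_or_nonempty with he | hne
    · obtain ⟨rfl, rfl⟩ := Set.union_empty_iff.1 he
      simp only [augment, Set.mem_empty_iff_false, false_and, exists_false, Set.ofPred_false,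
        Set.union_empty] at h₁ h₂
      exact base D (hD.mono h₂) ⟨Γ₀, h₁, d⟩
    · obtain ⟨A, hA, hmax⟩ := Set.exists_max_image (X₁ ∪ X₂) id (hfin₁.union hfin₂) hne
      have hAI : A ∈ I := hA.elim (fun h => (hX₁ h).2) (fun h => (hX₂ h).1)
      refine hI A hAI D (hD.mono (h₂.trans (augment_mono fun B hB => ?_)))
        ⟨Γ₀, h₁.trans (augment_mono fun B hB => ?_), d⟩
      · exact ⟨hmax B (.inr hB), (hX₂ hB).2⟩
      · exact ⟨(hX₁ hB).1, hmax B (.inl hB)⟩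
  have stage (A : Sent S) : Consistent (acc (X ∩ Set.Iic A)) (rej (Set.Iic A \ X)) := by
    induction A using WellFoundedLT.induction with
    | ind A ih =>
    have hlim := limit (Set.Iio A) ih
    have fresh {W : Sent S → S.Const → Sent S → Prop} {Δ Y : Set (Sent S)}
        (hW : ∀ {B c C d}, W B c C → C.Occurs d → B.Occurs d ∨ d = c)
        (hΔ : ∀ B ∈ Δ, ¬ B.Occurs (f A)) (hY : Y ⊆ Set.Iio A) :
        ∀ B ∈ augment W f Δ Y, ¬ B.Occurs (f A) := by
      rintro C (hC | ⟨B, hB, rfl | hC⟩) hocc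
      · exact hΔ C hC hocc
      · exact hf A C (hY hB).le hocc
      · rcases hW hC hocc with h | h
        · exact hf A B (hY hB).le h
        · exact hf' A B (hY hB) h
    have fT := fresh (Y := X ∩ Set.Iio A) TrueWitness.occurs (hΓ A)
      Set.inter_subset_right
    have fF := fresh (W := FalseWitness) (Δ := {A₀}) (Y := Set.Iio A \ X) FalseWitness.occurs
      (fun B hB => hB ▸ hA₀ A) Set.sdiff_subset
    have fA := hf A A le_rfl
    by_cases hA : A ∈ X
    · have hcon := (hX A).1 hA
      have h₁ : X ∩ Set.Iic A ⊆ insert A (X ∩ Set.Iio A) := fun B ⟨hB, hBA⟩ =>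
        (le_iff_eq_or_lt.1 hBA).imp_right fun h => ⟨hB, h⟩
      have h₂ : Set.Iic A \ X ⊆ Set.Iio A \ X := fun B ⟨hBA, hB⟩ =>
        ⟨lt_of_le_of_ne hBA fun h => hB (h ▸ hA), hB⟩
      rcases augment_insert_subset (W := TrueWitness) (f := f) (Γ := Γ) h₁
        (fun _ _ h h' => h.unique h') with hs | ⟨C, hC, hs⟩
      · exact hcon.anti hs (augment_mono h₂)
      · exact (hcon.insert_trueWitness hC fA fT fF).anti hs (augment_mono h₂)
    · have hcon := hlim.insert_or ⟨A₀, .inl rfl⟩ A (fun h => hA ((hX A).2 h))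
      have h₁ : X ∩ Set.Iic A ⊆ X ∩ Set.Iio A := fun B ⟨hB, hBA⟩ =>
        ⟨hB, lt_of_le_of_ne hBA fun h => hA (h ▸ hB)⟩
      have h₂ : Set.Iic A \ X ⊆ insert A (Set.Iio A \ X) := fun B ⟨hBA, hB⟩ =>
        (le_iff_eq_or_lt.1 hBA).imp_right fun h => ⟨h, hB⟩
      rcases augment_insert_subset (W := FalseWitness) (f := f) (Γ := {A₀}) h₂
        (fun _ _ h h' => h.unique h') with hs | ⟨C, hC, hs⟩
      · exact hcon.anti (augment_mono h₁) hs
      · exact (hcon.insert_falseWitness hC fA fT fF).anti (augment_mono h₁) hs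
  have total : Consistent (acc X) (rej Xᶜ) := by
    have := limit Set.univ fun A _ => stage A
    rwa [Set.inter_univ, ← Set.compl_eq_univ_sdiff] at this
  -- The final pair is consistent and decides every sentence, which yields all that is required.
  have closed {A : Sent S} (hA : Provable (acc X) A) : A ∈ X :=
    by_contra fun h => total A (.of_mem (mem_augment h)) hA
  have notMem {A : Sent S} (hA : A ∈ rej Xᶜ) : A ∉ X := fun h =>
    total A (.of_mem hA) (.of_mem (mem_augment h))
  refine ⟨X, ⟨fun hA => closed (hA.mono fun _ => mem_augment), fun {A B} hAB => ?_,
    fun {x E} hx hE => ?_, fun {x E} hx hE => ?_, fun {x E} hx hE => ?_, fun {x E} hx hE => ?_⟩,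
    fun B hB => closed (.of_mem (.inl hB)), notMem (.inl rfl)⟩
  · by_contra! hn
    exact total _ (.or (.of_mem (mem_augment hn.1)) (.of_mem (mem_augment hn.2)))
      (.of_mem (mem_augment hAB))
  · exact ⟨_, closed (.of_mem (mem_augment_of_witness hE ⟨x, E, hx, .inl ⟨rfl, rfl⟩⟩))⟩
  · exact ⟨_, closed (.of_mem (mem_augment_of_witness hE ⟨x, E, hx, .inr ⟨rfl, rfl⟩⟩))⟩
  · by_contra hn
    exact notMem (mem_augment_of_witness hn ⟨x, E, hx, .inl ⟨rfl, rfl⟩⟩) (hE _)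
  · by_contra hn
    exact notMem (mem_augment_of_witness hn ⟨x, E, hx, .inr ⟨rfl, rfl⟩⟩) (hE _)

end Saturation

/-! ### Fresh witnesses for all sentences -/

open Cardinal

/-- The constructors of formulas, with their arguments that are not formulas: atomic formulas;
negation (`none`) and the two quantifiers with their variables; the two binary connectives. -/
abbrev Form.Shape (S : Signature.{u, v}) : Type (max u v) :=
  (Σ n, S.Pred n × (Fin n → Term S)) ⊕ Option (Bool × ℕ) ⊕ Bool

/-- The type that indexes the immediate subformulas of a formula of a given shape. -/
abbrev Form.Arity : Form.Shape S → Type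
  | .inl _ => Empty
  | .inr (.inl _) => Unit
  | .inr (.inr _) => Bool

/-- Formulas as well-founded trees. -/
def Form.toW : Form S → WType (Form.Arity (S := S))
  | atom P t => ⟨.inl ⟨_, P, t⟩, Empty.elim⟩
  | neg A => ⟨.inr (.inl none), fun _ => A.toW⟩
  | all x A => ⟨.inr (.inl (some (true, x))), fun _ => A.toW⟩
  | ex x A => ⟨.inr (.inl (some (false, x))), fun _ => A.toW⟩
  | and A B => ⟨.inr (.inr true), fun i : Bool => if i then A.toW else B.toW⟩
  | or A B => ⟨.inr (.inr false), fun i : Bool => if i then A.toW else B.toW⟩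

theorem Form.toW_injective : Function.Injective (Form.toW (S := S)) := by
  intro A
  induction A with
  | atom P t =>
    intro B h
    cases B <;> simp only [toW, WType.mk.injEq, reduceCtorEq, false_and, Sum.inl.injEq] at h
    obtain ⟨⟨⟩, -⟩ := h
    rfl
  | neg A ih =>
    intro B h
    cases B <;> simp only [toW, WType.mk.injEq, reduceCtorEq, false_and, Sum.inr.injEq,
      Sum.inl.injEq, heq_eq_eq, true_and] at h
    rw [ih (congrFun h ())]
  | all x A ih =>
    intro B h
    cases B <;> simp only [toW, WType.mk.injEq, reduceCtorEq, false_and, Sum.inr.injEq,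
      Sum.inl.injEq, Option.some.injEq, Prod.mk.injEq, true_and] at h
    obtain ⟨rfl, h⟩ := h
    rw [ih (congrFun (eq_of_heq h) ())]
  | ex x A ih =>
    intro B h
    cases B <;> simp only [toW, WType.mk.injEq, reduceCtorEq, false_and, Sum.inr.injEq,
      Sum.inl.injEq, Option.some.injEq, Prod.mk.injEq, true_and] at h
    obtain ⟨rfl, h⟩ := h
    rw [ih (congrFun (eq_of_heq h) ())]
  | and A B ihA ihB =>
    intro B h
    cases B <;> simp only [toW, WType.mk.injEq, reduceCtorEq, false_and, Sum.inr.injEq,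
      heq_eq_eq, true_and] at h
    rw [ihA (congrFun h true), ihB (congrFun h false)]
  | or A B ihA ihB =>
    intro B h
    cases B <;> simp only [toW, WType.mk.injEq, reduceCtorEq, false_and, Sum.inr.injEq,
      heq_eq_eq, true_and] at h
    rw [ihA (congrFun h true), ihB (congrFun h false)]

/-- An infinite cardinal that bounds the number of constants and the number of predicate letters
bounds the number of formulas. -/
theorem Form.mk_le {K : Type (max u v)} [Infinite K] (i : S.Const ↪ K)
    (j : (Σ n, S.Pred n) ↪ K) : #(Form S) ≤ #K := by
  have hK : ℵ₀ ≤ #K := Cardinal.aleph0_le_mk K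
  let g : Term S → ℕ ⊕ K := fun t => match t with
    | .var x => .inl x
    | .const c => .inr (i c)
  have hg : Function.Injective g := by
    rintro (x | c) (y | d) h <;> simp_all [g]
  have hatom : #(Σ n, S.Pred n × (Fin n → Term S)) ≤ #K := by
    let f : (Σ n, S.Pred n × (Fin n → Term S)) → K × List (ℕ ⊕ K) := fun a =>
      (j ⟨a.1, a.2.1⟩, List.ofFn fun k => g (a.2.2 k))
    have hf : Function.Injective f := by
      rintro ⟨n, P, t⟩ ⟨m, Q, t'⟩ h
      simp only [f, Prod.mk.injEq, EmbeddingLike.apply_eq_iff_eq, Sigma.mk.injEq] at h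
      obtain ⟨⟨rfl, hPQ⟩, h⟩ := h
      obtain rfl := eq_of_heq hPQ
      have := List.ofFn_injective h
      obtain rfl : t = t' := funext fun k => hg (congrFun this k)
      rfl
    refine (Cardinal.mk_le_of_injective hf).trans ?_
    simp [Cardinal.mul_eq_self hK, Cardinal.add_eq_right hK hK]
  have hrest : #(Option (Bool × ℕ) ⊕ Bool) ≤ ℵ₀ := Cardinal.mk_le_aleph0
  have : ∀ a : Form.Shape S, Finite (Form.Arity a)
    | .inl _ => inferInstanceAs (Finite Empty)
    | .inr (.inl _) => inferInstanceAs (Finite Unit)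
    | .inr (.inr _) => inferInstanceAs (Finite Bool)
  refine (Cardinal.mk_le_of_injective Form.toW_injective).trans
    (WType.cardinalMk_le_max_aleph0_of_finite'.trans (max_le ?_ hK))
  rw [Cardinal.mk_sum, Cardinal.lift_uzero, Cardinal.lift_uzero]
  refine Cardinal.add_le_of_le hK ?_ ?_
  · exact hatom
  · exact (Cardinal.lift_le_aleph0.2 hrest).trans hK

/-- If `α` is well-ordered so that its initial segments are smaller than `K`, there is room to pick
for each `a` an element of `K` that has not been picked before and is in none of the finite sets
given up to `a`. -/
theorem exists_fresh_choice {α K : Type u} [LinearOrder α] [WellFoundedLT α] [Infinite K]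
    (hα : ∀ a : α, #(Set.Iio a) < #K) (occ : α → Set K) (hocc : ∀ a, (occ a).Finite) :
    ∃ f : α → K, (∀ a b, b ≤ a → f a ∉ occ b) ∧ ∀ a b, b < a → f a ≠ f b := by
  have hK : ℵ₀ ≤ #K := Cardinal.aleph0_le_mk K
  have step (a : α) (g : ∀ b, b < a → K) :
      ∃ k, k ∉ (⋃ b : Set.Iio a, insert (g b b.2) (occ b)) ∪ occ a := by
    have hfin (b : Set.Iio a) : (insert (g b b.2) (occ b)).Finite := (hocc b).insert _
    have h₁ : #(⋃ b : Set.Iio a, insert (g b b.2) (occ b) : Set K) < #K := by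
      rcases finite_or_infinite (Set.Iio a) with h | h
      · exact (Cardinal.lt_aleph0_iff_set_finite.2 (Set.finite_iUnion hfin)).trans_le hK
      · refine lt_of_le_of_lt ?_ (hα a)
        calc _ ≤ Cardinal.sum fun b : Set.Iio a => #(insert (g b b.2) (occ b) : Set K) :=
              Cardinal.mk_iUnion_le_sum_mk
          _ ≤ Cardinal.sum fun _ : Set.Iio a => ℵ₀ :=
              Cardinal.sum_le_sum _ _ fun b =>
                (Cardinal.lt_aleph0_iff_set_finite.2 (hfin b)).le
          _ = #(Set.Iio a) := by simp
    have h₂ : #(occ a) < #K := (Cardinal.lt_aleph0_iff_set_finite.2 (hocc a)).trans_le hK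
    have h₃ := (Cardinal.mk_union_le _ _).trans_lt (Cardinal.add_lt_of_lt hK h₁ h₂)
    by_contra! hall
    rw [Set.eq_univ_of_forall hall, Cardinal.mk_univ] at h₃
    exact h₃.false
  choose pick hpick using step
  let f : α → K := (wellFounded_lt (α := α)).fix pick
  have hf (a : α) : f a = pick a fun b _ => f b := WellFounded.fix_eq _ _ _
  have key (a : α) : f a ∉ (⋃ b : Set.Iio a, insert (f b) (occ b)) ∪ occ a := by
    have := hpick a fun b _ => f b
    rwa [← hf] at this
  refine ⟨f, fun a b hb h => key a ?_, fun a b hb h => key a (.inl ?_)⟩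
  · rcases hb.eq_or_lt with rfl | hb
    · exact .inr h
    · exact .inl (Set.mem_iUnion.2 ⟨⟨b, hb⟩, .inr h⟩)
  · exact Set.mem_iUnion.2 ⟨⟨b, hb⟩, .inl h⟩

/-! ### Completeness -/

/-- Completeness. The language is extended by as many new constants as the extended language has
sentences, and the countermodel is the reduct of the canonical model of a saturated theory. -/
theorem Provable.complete {Γ : Set (Sent S)} {A : Sent S}
    (h : Entails.{u, v, max u v} Γ A) : Provable Γ A := by
  by_contra hn
  have := S.infinite
  let K : Type (max u v) := S.Const ⊕ Σ n, S.Pred n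
  have hK : ℵ₀ ≤ #K := Cardinal.aleph0_le_mk K
  have hKK : #(K ⊕ K) ≤ #K := by rw [Cardinal.mk_sum]; simp [Cardinal.add_eq_self hK]
  obtain ⟨e⟩ : Nonempty (K ⊕ K ↪ K) := hKK
  have hForm : #(Form (S.addConsts K)) ≤ #K :=
    Form.mk_le (S := S.addConsts K)
      ((Function.Embedding.inl.sumMap (Function.Embedding.refl K)).trans e)
      Function.Embedding.inr
  have hSent : #(Sent (S.addConsts K)) ≤ #K := (Cardinal.mk_subtype_le _).trans hForm
  obtain ⟨_, _, hord⟩ := Cardinal.exists_ord_eq_type_lt (Sent (S.addConsts K))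
  obtain ⟨f, hf, hf'⟩ := exists_fresh_choice
    (fun B : Sent (S.addConsts K) => (Cardinal.mk_Iio_lt B hord).trans_le hSent)
    (fun B => {k | Sent.Occurs (S := S.addConsts K) (Sum.inr k) B})
    (fun B => B.1.finite_occurs.preimage Sum.inr_injective.injOn)
  obtain ⟨T, hT, hΓ, hA⟩ := exists_saturated (S := S.addConsts K) (Γ := Sent.lift K '' Γ)
    (f := fun B => Sum.inr (f B)) hf (fun B C hC h => hf' B C hC (Sum.inr_injective h))
    (by rintro B _ ⟨C, -, rfl⟩; exact Form.not_occurs_lift _ C.1)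
    (A₀ := A.lift K) (fun B => Form.not_occurs_lift _ A.1) (fun h => hn h.of_lift)
  obtain ⟨a⟩ := hT.model.nonempty
  have holds (B : Sent S) :
      (hT.model.comap (Renaming.inclusion S K)).Holds B ↔ B.lift K ∈ T := by
    refine (Struct.holds_iff_sat (hT.model.comap (Renaming.inclusion S K)) (fun _ => a) B).trans
      (Iff.trans ?_ (hT.sat_model_iff (fun _ => a) (B.lift K)).1)
    change _ ↔ hT.model.Sat (B.1.lift K) _ _
    rw [Form.lift_eq_map]
    exact (Struct.sat_map (Renaming.inclusion S K) hT.model B.1 true _).symm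
  exact hA ((holds A).1 (h _ fun B hB => (holds B).2 (hΓ ⟨B, hB, rfl⟩)))

end QFDE

theorem mainTheorem7 (S : QFDE.Signature.{u, v}) :
    (∀ 𝔄 : QFDE.Struct.{u, v, w} S,
      ∃! val : QFDE.Sent 𝔄.diagram → Bool, 𝔄.IsInducedValuation val) ∧
    (∀ (Γ : Set (QFDE.Sent S)) (A : QFDE.Sent S),
      QFDE.Provable Γ A → QFDE.Entails.{u, v, w} Γ A) ∧
    (∀ (Γ : Set (QFDE.Sent S)) (A : QFDE.Sent S),
      QFDE.Entails.{u, v, max u v} Γ A → QFDE.Provable Γ A) :=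
  ⟨fun 𝔄 => 𝔄.existsUnique_isInducedValuation, fun _ _ => QFDE.Provable.sound,
    fun _ _ => QFDE.Provable.complete⟩
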